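/- Let $M=(m_{ij})$ be a right-angled Coxeter matrix over a finite set $I$ (so $m_{ij}\in\{2,\infty\}$ for $i\neq j$), and let $\Delta$ be a locally finite semiregular right-angled building of type $M$, endowed with a legal coloring with finite color sets $\Omega_i$ $(i\in I)$. That is, each chamber $c$ has an $i$-color $\lambda_i(c)\in\Omega_i$ for every $i\in I$, such that on every $i$-panel $\lambda_i$ restricts to a bijection onto $\Omega_i$ and $\lambda_j$ is constant for each $j\ne i$. Let $\operatorname{Aut}(\Delta)$ be the group of type-preserving automorphisms of $\Delta$. For $g\in\operatorname{Aut}(\Delta)$ and an $i$-panel $P$, let $\sigma(g,P)=\lambda_i|_{gP}\circ g|_P\circ(\lambda_i|_P)^{-1}\in\operatorname{Sym}(\Omega_i)$ be the local action of $g$ at $P$. For each $i\in I$ let $F_i\le \acute F_i\le\operatorname{Sym}(\Omega_i)$ be permutation groups such that every element of $\acute F_i$ stabilizes each $F_i$-orbit, and write $F=(F_i)_{i\in I}$ and $\acute F=(\acute F_i)_{i\in I}$. Let $U(F)$ be the group of all $g\in\operatorname{Aut}(\Delta)$ with $\sigma(g,P)\in F_i$ for all $i\in I$ and all $i$-panels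 $P$, and define $U(\acute F)$ likewise. Let $G(F,\acute F)$ be the group of all $g\in U(\acute F)$ such that $\sigma(g,P)\in F_i$ for every $i\in I$ and all but finitely many $i$-panels $P$; the exceptional panels are called the singularities of $g$. Two panels are parallel if each is the image of the other under projection. For a panel $P$, let $K_P$ be the subgroup of all $g\in G(F,\acute F)$ that stabilize $P$ and all of whose singularities are parallel to $P$. An $i$-panel is called a rung if it is contained in a residue of type $\{i,j,k\}$ for some $j,k\in I$ with $m_{ij}=m_{ik}=2$ and $m_{jk}=\infty$. Two $i$-panels $P,P'$ are called harmonious if for each $k\neq i$ the constant values of $\lambda_k$ on $P$ and on $P'$ lie in the same $F_k$-orbit. Let $\mathcal H$ be a set of panels that are not rungs, containing, for each $i\in I$, exactly one representative of each class of harmonious $i$-panels that are not rungs. Then \[ G(F,\acute F)=\bigl\langle\, U(F),\ K_P \mid P\in\mathcal H \,\bigr\rangle . \] -/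

import Mathlib

namespace RightAngled

universe u v w

/-- All off-diagonal entries of the Coxeter matrix are `2` or `∞` (which Mathlib encodes as `0`). -/
def IsRightAngled {I : Type u} (M : CoxeterMatrix I) : Prop :=
  ∀ i j, i ≠ j → M i j = 2 ∨ M i j = 0

/-- The standard generator of type `i` in the Coxeter group of `M`. -/
def gen {I : Type u} (M : CoxeterMatrix I) (i : I) : M.Group := M.toCoxeterSystem.simple i

/-- Word length in the Coxeter group of `M`. -/
noncomputable def len {I : Type u} (M : CoxeterMatrix I) (x : M.Group) : ℕ :=
  M.toCoxeterSystem.length x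

/-- The standard parabolic subgroup of type `J`. -/
def parabolic {I : Type u} (M : CoxeterMatrix I) (J : Set I) : Subgroup M.Group :=
  Subgroup.closure (gen M '' J)

/-- A building of type `M` with set of chambers `Δ`, given by its Weyl distance. -/
structure Building {I : Type u} (M : CoxeterMatrix I) (Δ : Type v) where
  /-- the Weyl distance -/
  δ : Δ → Δ → M.Group
  δ_eq_one_iff : ∀ c d, δ c d = 1 ↔ c = d
  δ_adjacent : ∀ (c d c' : Δ) (i : I), δ c' c = gen M i →
    (δ c' d = gen M i * δ c d ∨ δ c' d = δ c d) ∧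
    (len M (gen M i * δ c d) = len M (δ c d) + 1 → δ c' d = gen M i * δ c d)
  exists_adjacent : ∀ (c d : Δ) (i : I), ∃ c', δ c' c = gen M i ∧ δ c' d = gen M i * δ c d

namespace Building

variable {I : Type u} {M : CoxeterMatrix I} {Δ : Type v} (B : Building M Δ)

/-- The gallery distance between two chambers. -/
noncomputable def dist (c d : Δ) : ℕ := len M (B.δ c d)

/-- The set `R` of chambers is a residue of type `J`. -/
def IsResidue (J : Set I) (R : Set Δ) : Prop :=
  ∃ c, R = {d | B.δ c d ∈ parabolic M J}

/-- The panels of type `i`, i.e. the residues of type `{i}`. -/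
def Panel (i : I) : Type v := {P : Set Δ // B.IsResidue {i} P}

/-- The group of (type-preserving) automorphisms of the building. -/
def Aut : Subgroup (Equiv.Perm Δ) where
  carrier := {g | ∀ c d, B.δ (g c) (g d) = B.δ c d}
  mul_mem' := by
    intro g h hg hh c d
    rw [Equiv.Perm.mul_apply, Equiv.Perm.mul_apply, hg, hh]
  one_mem' := by
    intro c d
    rfl
  inv_mem' := by
    intro g hg c d
    have h := hg (g⁻¹ c) (g⁻¹ d)
    simpa using h.symm

variable {B}

theorem Aut.δ_eq (g : B.Aut) (c d : Δ) : B.δ (g.1 c) (g.1 d) = B.δ c d := g.2 c d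

theorem IsResidue.image {J : Set I} {R : Set Δ} (hR : B.IsResidue J R) (g : B.Aut) :
    B.IsResidue J (g.1 '' R) := by
  obtain ⟨c, rfl⟩ := hR
  refine ⟨g.1 c, ?_⟩
  ext d
  constructor
  · rintro ⟨e, he, rfl⟩
    simpa [Aut.δ_eq] using he
  · intro hd
    refine ⟨g.1⁻¹ d, ?_, by simp⟩
    have := Aut.δ_eq g c (g.1⁻¹ d)
    rw [show g.1 (g.1⁻¹ d) = d by simp] at this
    change B.δ c (g.1⁻¹ d) ∈ parabolic M J
    rw [← this]
    exact hd

/-- Automorphisms act on panels by taking images. -/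
instance panelAction (i : I) : MulAction B.Aut (B.Panel i) where
  smul g P := ⟨g.1 '' P.1, P.2.image g⟩
  one_smul P := Subtype.ext (Set.image_id P.1)
  mul_smul g h P := Subtype.ext (Set.image_comp g.1 h.1 P.1)

theorem coe_smul {i : I} (g : B.Aut) (P : B.Panel i) : (g • P).1 = g.1 '' P.1 := rfl

variable (B)

/-- `d` is a chamber of `R` at minimal distance from `c`. When `R` is a residue there is exactly
one such `d`, the projection of `c` on `R`. -/
def IsProj (R : Set Δ) (c d : Δ) : Prop := d ∈ R ∧ ∀ e ∈ R, B.dist c d ≤ B.dist c e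

/-- The set of projections on `R` of the chambers of `S`. -/
def projSet (R S : Set Δ) : Set Δ := {d | ∃ c ∈ S, B.IsProj R c d}

/-- Two residues are parallel if each is the projection of the other. -/
def Parallel (R S : Set Δ) : Prop := B.projSet R S = R ∧ B.projSet S R = S

variable {B}

theorem IsProj.image {R : Set Δ} {c d : Δ} (h : B.IsProj R c d) (g : B.Aut) :
    B.IsProj (g.1 '' R) (g.1 c) (g.1 d) := by
  refine ⟨Set.mem_image_of_mem _ h.1, ?_⟩
  rintro _ ⟨e, he, rfl⟩
  simpa [dist, Aut.δ_eq] using h.2 e he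

theorem projSet_image (R S : Set Δ) (g : B.Aut) :
    B.projSet (g.1 '' R) (g.1 '' S) = g.1 '' B.projSet R S := by
  ext d
  constructor
  · rintro ⟨_, ⟨c, hc, rfl⟩, hd⟩
    refine ⟨g.1⁻¹ d, ⟨c, hc, ?_⟩, by simp⟩
    have := hd.image g⁻¹
    simpa [Set.image_image] using this
  · rintro ⟨e, ⟨c, hc, he⟩, rfl⟩
    exact ⟨g.1 c, Set.mem_image_of_mem _ hc, he.image g⟩

theorem Parallel.image {R S : Set Δ} (h : B.Parallel R S) (g : B.Aut) :
    B.Parallel (g.1 '' R) (g.1 '' S) :=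
  ⟨by rw [projSet_image, h.1], by rw [projSet_image, h.2]⟩

variable (B)

/-- A residue `R` is a ladder whose rungs are its panels of type `i`: its type is `{i, j, k}` with
`m_ij = m_ik = 2` and `m_jk = ∞`. -/
def IsLadder (i : I) (R : Set Δ) : Prop :=
  ∃ j k, M i j = 2 ∧ M i k = 2 ∧ M j k = 0 ∧ B.IsResidue {i, j, k} R

variable {B}

/-- The panel `P` is a rung of some ladder of the building. -/
def IsRung {i : I} (P : B.Panel i) : Prop := ∃ R, B.IsLadder i R ∧ P.1 ⊆ R

end Building

/-- A legal coloring of the building `B` with color sets `Ω i`. -/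
structure LegalColoring {I : Type u} {M : CoxeterMatrix I} {Δ : Type v} (B : Building M Δ)
    (Ω : I → Type w) where
  /-- the `i`-th color of a chamber -/
  color : ∀ i, Δ → Ω i
  bij : ∀ (i : I) (P : B.Panel i), Function.Bijective fun c : P.1 => color i c.1
  const : ∀ (i j : I) (P : B.Panel i), j ≠ i → ∀ c ∈ P.1, ∀ d ∈ P.1, color j c = color j d

/-- The Young subgroup of all permutations stabilizing each block of a partition. -/
def youngSubgroup {X : Type w} (r : Setoid X) : Subgroup (Equiv.Perm X) where
  carrier := {f | ∀ x, r (f x) x}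
  mul_mem' := by
    intro f g hf hg x
    exact r.trans (hf (g x)) (hg x)
  one_mem' := fun x => r.refl x
  inv_mem' := by
    intro f hf x
    have := hf (f⁻¹ x)
    rw [show f (f⁻¹ x) = x by simp] at this
    exact r.symm this

/-- The Young overgroup of a permutation group, associated with its partition into orbits. -/
def youngOvergroup {X : Type w} (G : Subgroup (Equiv.Perm X)) : Subgroup (Equiv.Perm X) :=
  youngSubgroup (MulAction.orbitRel G X)

namespace LegalColoring

open Building

variable {I : Type u} {M : CoxeterMatrix I} {Δ : Type v} {B : Building M Δ} {Ω : I → Type w}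
  (col : LegalColoring B Ω)

/-- The bijection from an `i`-panel to the set of `i`-colors. -/
noncomputable def label {i : I} (P : B.Panel i) : P.1 ≃ Ω i := Equiv.ofBijective _ (col.bij i P)

/-- The local action of `g` at `P`: the bijection `g : P → g P` read in colors. -/
noncomputable def localAction (g : B.Aut) {i : I} (P : B.Panel i) : Equiv.Perm (Ω i) :=
  ((col.label P).symm.trans (g.1.image P.1)).trans (col.label (g • P))

theorem localAction_color (g : B.Aut) {i : I} (P : B.Panel i) {c : Δ} (hc : c ∈ P.1) :
    col.localAction g P (col.color i c) = col.color i (g.1 c) := by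
  have h : (col.label P).symm (col.color i c) = ⟨c, hc⟩ :=
    (Equiv.symm_apply_eq _).2 rfl
  simp only [localAction, Equiv.trans_apply, h]
  rfl

theorem exists_color {i : I} (P : B.Panel i) (x : Ω i) : ∃ c ∈ P.1, col.color i c = x := by
  obtain ⟨c, hc⟩ := (col.bij i P).2 x
  exact ⟨c.1, c.2, hc⟩

theorem localAction_one {i : I} (P : B.Panel i) : col.localAction 1 P = 1 := by
  ext x
  obtain ⟨c, hc, rfl⟩ := col.exists_color P x
  exact col.localAction_color 1 P hc

theorem localAction_mul (g h : B.Aut) {i : I} (P : B.Panel i) :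
    col.localAction (g * h) P = col.localAction g (h • P) * col.localAction h P := by
  ext x
  obtain ⟨c, hc, rfl⟩ := col.exists_color P x
  rw [col.localAction_color _ P hc, Equiv.Perm.mul_apply, col.localAction_color _ P hc,
    col.localAction_color _ (h • P) (Set.mem_image_of_mem _ hc)]
  rfl

theorem localAction_inv (g : B.Aut) {i : I} (P : B.Panel i) :
    col.localAction g⁻¹ P = (col.localAction g (g⁻¹ • P))⁻¹ := by
  refine eq_inv_of_mul_eq_one_right ?_
  rw [← localAction_mul, mul_inv_cancel, localAction_one]

/-- The set of singularities of type `i` of `g` with respect to the local data `F`. -/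
def singularities (F : ∀ i, Subgroup (Equiv.Perm (Ω i))) (g : B.Aut) (i : I) :
    Set (B.Panel i) :=
  {P | col.localAction g P ∉ F i}

theorem singularities_mul (F : ∀ i, Subgroup (Equiv.Perm (Ω i))) (g h : B.Aut) {i : I}
    {P : B.Panel i} (hP : P ∈ col.singularities F (g * h) i) :
    h • P ∈ col.singularities F g i ∨ P ∈ col.singularities F h i := by
  by_contra hcon
  simp only [singularities, Set.mem_ofPred_eq, not_or, not_not] at hcon
  apply hP
  rw [localAction_mul]
  exact (F i).mul_mem hcon.1 hcon.2

theorem singularities_inv (F : ∀ i, Subgroup (Equiv.Perm (Ω i))) (g : B.Aut) {i : I}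
    {P : B.Panel i} (hP : P ∈ col.singularities F g⁻¹ i) :
    g⁻¹ • P ∈ col.singularities F g i := by
  intro hcon
  apply hP
  rw [localAction_inv]
  exact (F i).inv_mem hcon

/-- The universal group `U(F)`. -/
def universal (F : ∀ i, Subgroup (Equiv.Perm (Ω i))) : Subgroup B.Aut where
  carrier := {g | ∀ (i : I) (P : B.Panel i), col.localAction g P ∈ F i}
  mul_mem' := by
    intro g h hg hh i P
    rw [localAction_mul]
    exact (F i).mul_mem (hg i _) (hh i P)
  one_mem' := by
    intro i P
    rw [localAction_one]
    exact (F i).one_mem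
  inv_mem' := by
    intro g hg i P
    rw [localAction_inv]
    exact (F i).inv_mem (hg i _)

/-- The group `G(F)` of automorphisms for which, for every `i`, the local action at all but
finitely many `i`-panels lies in `F i`. -/
def almostUniversal (F : ∀ i, Subgroup (Equiv.Perm (Ω i))) : Subgroup B.Aut where
  carrier := {g | ∀ i : I, (col.singularities F g i).Finite}
  mul_mem' := by
    intro g h hg hh i
    refine (((hg i).preimage (MulAction.injective h).injOn).union (hh i)).subset ?_
    intro P hP
    exact col.singularities_mul F g h hP
  one_mem' := by
    intro i
    convert Set.finite_empty
    ext P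
    simp [singularities, localAction_one, (F i).one_mem]
  inv_mem' := by
    intro g hg i
    refine ((hg i).preimage (MulAction.injective g⁻¹).injOn).subset ?_
    intro P hP
    exact col.singularities_inv F g hP

/-- The restricted universal group `G(F, F') = G(F) ∩ U(F')`. -/
def restricted (F F' : ∀ i, Subgroup (Equiv.Perm (Ω i))) : Subgroup B.Aut :=
  col.almostUniversal F ⊓ col.universal F'

/-- The subgroup `K_P` of `G(F, F')` of all elements that stabilize the panel `P` and whose
singularities are all parallel to `P`. -/
def panelGroup (F F' : ∀ i, Subgroup (Equiv.Perm (Ω i))) {i : I} (P : B.Panel i) :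
    Subgroup B.Aut where
  carrier := {g | g ∈ col.restricted F F' ∧ g • P = P ∧
    ∀ (j : I), ∀ Q ∈ col.singularities F g j, B.Parallel Q.1 P.1}
  mul_mem' := by
    rintro g h ⟨hg, hgP, hgs⟩ ⟨hh, hhP, hhs⟩
    refine ⟨mul_mem hg hh, by rw [mul_smul, hhP, hgP], ?_⟩
    intro j Q hQ
    rcases col.singularities_mul F g h hQ with h1 | h1
    · have h2 := (hgs j _ h1).image h⁻¹
      have h3 : h⁻¹ • P = P := by rw [inv_smul_eq_iff, hhP]
      rwa [← coe_smul, ← coe_smul, inv_smul_smul, h3] at h2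
    · exact hhs j Q h1
  one_mem' := by
    refine ⟨one_mem _, one_smul _ _, ?_⟩
    intro j Q hQ
    exact absurd (by rw [localAction_one]; exact (F j).one_mem) hQ
  inv_mem' := by
    rintro g ⟨hg, hgP, hgs⟩
    refine ⟨inv_mem hg, by rw [inv_smul_eq_iff, hgP], ?_⟩
    intro j Q hQ
    have h2 := (hgs j _ (col.singularities_inv F g hQ)).image g
    rwa [← coe_smul, ← coe_smul, smul_inv_smul, hgP] at h2

/-- Two residues `R`, `R'` of type `J` are harmonious with respect to `F`: for `k ∉ J`, their
(constant) `k`-colors lie in the same orbit of `F k`. -/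
def Harmonious (F : ∀ i, Subgroup (Equiv.Perm (Ω i))) (J : Set I) (R R' : Set Δ) : Prop :=
  ∀ k ∉ J, ∀ c ∈ R, ∀ c' ∈ R', col.color k c' ∈ MulAction.orbit (F k) (col.color k c)

/-- `H` is a set of representatives, up to harmony, of the panels that are not rungs (`H i`
contains the representatives of type `i`). -/
def IsRepresentatives (F : ∀ i, Subgroup (Equiv.Perm (Ω i))) (H : ∀ i, Set (B.Panel i)) : Prop :=
  (∀ i, ∀ P ∈ H i, ¬ IsRung P) ∧
  ∀ (i : I) (P : B.Panel i), ¬ IsRung P → ∃! Q, Q ∈ H i ∧ col.Harmonious F {i} P.1 Q.1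

end LegalColoring

end RightAngled

/-!
The singularities of `g ∈ G(F, F')` are removed one at a time. Automorphisms have equal local
actions at parallel `i`-panels, and two `i`-panels are parallel when they are joined by a gallery
whose types are orthogonal to `i`. An `i`-panel is a rung exactly when two of these types generate
an infinite dihedral group; then infinitely many panels are parallel to it, so that it is no
singularity (`infinite_of_isRung`). Otherwise the types orthogonal to `i` commute pairwise, and
only finitely many panels are parallel to the given one (`finite_linked`). For a singularity `P` of
`g` there is `h ∈ K_P` with the same local action at `P` as `g` (`exists_mem_panelGroup`), and
`g * h⁻¹` has fewer singularities than `g`. Finally, harmonious panels are conjugate under `U(F)`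
(`exists_mem_universal_smul_eq`), so that `K_P` is needed for one panel of each class only.

Both existence statements rest on `exists_aut`: any two legal colorings are conjugate under an
automorphism that takes a given chamber to any chamber with the corresponding colors. The
automorphism sends the end of a gallery from the first chamber to the end of the gallery with the
same types and colors from the second one. This preserves the Weyl distance because the minimal
galleries to a chamber differ by interchanging steps of commuting types
(`MinimalPair.exists_of_descent`). For `h ∈ K_P`, the new coloring leaves the `j`-colors with
`j ≠ i` as they are and applies to the `i`-color of a chamber `d` a permutation in `F i` that
depends only on the `i`-color `x` of the projection of `d` on `P` and that agrees at `x` with the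
wanted local action `τ`; it exists because `τ` preserves the orbits of `F i`. The coloring is legal
because the projection on `P` is constant on every panel that is not parallel to `P`
(`isGate_or_linked`).

The facts needed on right-angled Coxeter groups follow from the exchange condition. It is obtained
from the action of the group on `W × ℤ/2` that records crossings of walls (`cocycleHom`).
-/

namespace RightAngled

/-! ### Right-angled Coxeter groups -/

section Coxeter

open CoxeterSystem

variable {I : Type*} {M : CoxeterMatrix I} {W : Type*} [Group W] (cs : CoxeterSystem M W)

/-- The action of the generator `s_i` on `W × ℤ/2`: conjugation by `s_i` in the first coordinate,
and a change of the second one at the single point `s_i`. -/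
noncomputable def cocycleGen (i : I) : Function.End (W × ZMod 2) := by
  classical
  exact fun p => (cs.simple i * p.1 * cs.simple i, p.2 + if p.1 = cs.simple i then 1 else 0)

theorem commute_simple {i j : I} (h : M i j = 2) :
    cs.simple i * cs.simple j = cs.simple j * cs.simple i := by
  have h1 := cs.simple_mul_simple_pow i j
  rw [h, pow_two] at h1
  have h2 := eq_inv_of_mul_eq_one_left h1
  simpa using h2

theorem cocycleGen_isLiftable (hM : IsRightAngled M) : M.IsLiftable (cocycleGen cs) := by
  classical
  have hsq : ∀ i, cocycleGen cs i * cocycleGen cs i = 1 := by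
    intro i
    funext p
    obtain ⟨t, e⟩ := p
    have h1 : cs.simple i * t * cs.simple i = cs.simple i ↔ t = cs.simple i := by
      constructor
      · intro h
        simpa [mul_assoc] using congrArg (fun x => cs.simple i * x * cs.simple i) h
      · rintro rfl
        simp
    change (_, _) = (t, e)
    refine Prod.ext ?_ ?_
    · simp [cocycleGen, mul_assoc]
    · simp only [cocycleGen, h1, add_assoc, CharTwo.add_self_eq_zero, add_zero]
  have hcomm : ∀ i j, M i j = 2 →
      cocycleGen cs i * cocycleGen cs j = cocycleGen cs j * cocycleGen cs i := by
    intro i j hij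
    have hc := commute_simple cs hij
    have key : ∀ a b : I, cs.simple a * cs.simple b = cs.simple b * cs.simple a → ∀ t,
        cs.simple a * t * cs.simple a = cs.simple b ↔ t = cs.simple b := by
      intro a b hab t
      constructor
      · intro h
        have := congrArg (fun x => cs.simple a * x * cs.simple a) h
        simpa [mul_assoc, ← hab] using this
      · rintro rfl
        rw [hab]; simp [mul_assoc]
    funext p
    obtain ⟨t, e⟩ := p
    change (_, _) = (_, _)
    refine Prod.ext ?_ ?_
    · simp only [cocycleGen]
      calc cs.simple i * (cs.simple j * t * cs.simple j) * cs.simple i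
          = (cs.simple i * cs.simple j) * t * (cs.simple j * cs.simple i) := by group
        _ = (cs.simple j * cs.simple i) * t * (cs.simple i * cs.simple j) := by rw [hc]
        _ = _ := by group
    · simp only [cocycleGen, key j i hc.symm, key i j hc]
      exact add_right_comm _ _ _
  intro i j
  by_cases hij : i = j
  · subst hij
    rw [hsq]; simp
  · rcases hM i j hij with h | h
    · rw [h, pow_two, ← mul_assoc, mul_assoc (cocycleGen cs i), ← hcomm i j h, ← mul_assoc, hsq,
        one_mul, hsq]
    · rw [h, pow_zero]

/-- The action of `W` on `W × ℤ/2` behind the exchange condition. -/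
noncomputable def cocycleHom (hM : IsRightAngled M) : W →* Function.End (W × ZMod 2) :=
  cs.lift ⟨cocycleGen cs, cocycleGen_isLiftable cs hM⟩

/-- The parity of the multiplicity of `t` in the right inversion sequence of a word for `w`, which
does not depend on the word. -/
noncomputable def crossing (hM : IsRightAngled M) (w t : W) : ZMod 2 :=
  (cocycleHom cs hM w (t, 0)).2

/-- The second coordinate counts the occurrences of `t` in the right inversion sequence. -/
theorem cocycleHom_wordProd (hM : IsRightAngled M) [DecidableEq W] (ω : List I) (t : W)
    (e : ZMod 2) : cocycleHom cs hM (cs.wordProd ω) (t, e) =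
      (cs.wordProd ω * t * (cs.wordProd ω)⁻¹, e + ((cs.rightInvSeq ω).count t : ZMod 2)) := by
  induction ω with
  | nil => simp; rfl
  | cons i ω ih =>
    rw [wordProd_cons, map_mul]
    change cocycleHom cs hM (cs.simple i) (cocycleHom cs hM (cs.wordProd ω) (t, e)) = _
    rw [ih, cocycleHom, lift_apply_simple]
    refine Prod.ext ?_ ?_
    · simp [cocycleGen, mul_assoc]
    · have h1 : cs.wordProd ω * t * (cs.wordProd ω)⁻¹ = cs.simple i ↔
          (cs.wordProd ω)⁻¹ * cs.simple i * cs.wordProd ω = t := by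
        constructor
        · intro h
          rw [← h]; group
        · rintro rfl
          group
      simp only [cocycleGen, h1, rightInvSeq, List.count_cons, beq_iff_eq]
      push_cast
      split_ifs <;> simp [add_assoc]

theorem cocycleHom_apply (hM : IsRightAngled M) (w t : W) (e : ZMod 2) :
    cocycleHom cs hM w (t, e) = (w * t * w⁻¹, e + crossing cs hM w t) := by
  classical
  obtain ⟨ω, rfl⟩ := cs.wordProd_surjective w
  rw [crossing, cocycleHom_wordProd, cocycleHom_wordProd]
  simp

theorem crossing_mul (hM : IsRightAngled M) (u v t : W) :
    crossing cs hM (u * v) t = crossing cs hM v t + crossing cs hM u (v * t * v⁻¹) := by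
  conv_lhs => rw [crossing, map_mul]
  change (cocycleHom cs hM u (cocycleHom cs hM v (t, 0))).2 = _
  rw [cocycleHom_apply, cocycleHom_apply]
  simp

theorem crossing_simple (hM : IsRightAngled M) [DecidableEq W] (i : I) (t : W) :
    crossing cs hM (cs.simple i) t = if t = cs.simple i then 1 else 0 := by
  rw [crossing, cocycleHom, lift_apply_simple]
  simp only [cocycleGen, zero_add]
  congr

theorem mem_rightInvSeq_of_crossing (hM : IsRightAngled M) {ω : List I} {t : W}
    (h : crossing cs hM (cs.wordProd ω) t ≠ 0) : t ∈ cs.rightInvSeq ω := by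
  classical
  by_contra hn
  rw [crossing, cocycleHom_wordProd, List.count_eq_zero_of_not_mem hn] at h
  simp at h

theorem length_mul_lt_of_crossing (hM : IsRightAngled M) {w t : W}
    (h : crossing cs hM w t ≠ 0) : cs.length (w * t) < cs.length w := by
  obtain ⟨ω, hω, rfl⟩ := cs.exists_isReduced w
  exact (cs.isRightInversion_of_mem_rightInvSeq hω (mem_rightInvSeq_of_crossing cs hM h)).2

theorem crossing_of_length_mul_lt (hM : IsRightAngled M) {w : W} {i : I}
    (h : cs.length (w * cs.simple i) < cs.length w) : crossing cs hM w (cs.simple i) ≠ 0 := by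
  classical
  intro h0
  have h1 : crossing cs hM (w * cs.simple i) (cs.simple i) ≠ 0 := by
    rw [crossing_mul, crossing_simple]
    simp [h0]
  have h2 := length_mul_lt_of_crossing cs hM h1
  rw [simple_mul_simple_cancel_right] at h2
  omega

/-- The exchange condition. -/
theorem exchange (hM : IsRightAngled M) {ω : List I} {i : I}
    (h : cs.length (cs.wordProd ω * cs.simple i) < cs.length (cs.wordProd ω)) :
    ∃ k < ω.length, cs.wordProd ω * cs.simple i = cs.wordProd (ω.eraseIdx k) := by
  have h1 := mem_rightInvSeq_of_crossing cs hM (crossing_of_length_mul_lt cs hM h)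
  obtain ⟨k, hk, hk2⟩ := List.getElem_of_mem h1
  refine ⟨k, by simpa using hk, ?_⟩
  rw [← cs.wordProd_mul_getD_rightInvSeq, List.getD_eq_getElem _ _ hk, hk2]

/-- The folding condition. -/
theorem folding (hM : IsRightAngled M) {w : W} {i k : I}
    (h1 : cs.length (cs.simple i * w) = cs.length w + 1)
    (h2 : cs.length (w * cs.simple k) = cs.length w + 1)
    (h3 : cs.length (cs.simple i * (w * cs.simple k)) < cs.length (w * cs.simple k)) :
    cs.simple i * w = w * cs.simple k := by
  obtain ⟨ω, hω, rfl⟩ := cs.exists_isReduced w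
  have h4 : cs.length (cs.wordProd (i :: ω) * cs.simple k) < cs.length (cs.wordProd (i :: ω)) := by
    rw [wordProd_cons, mul_assoc]
    omega
  obtain ⟨m, hm, h5⟩ := exchange cs hM h4
  cases m with
  | zero =>
    simp only [wordProd_cons, List.eraseIdx_cons_zero] at h5
    nth_rw 2 [← h5]
    simp
  | succ m =>
    exfalso
    simp only [wordProd_cons, List.eraseIdx_cons_succ, mul_assoc, mul_right_inj] at h5
    have h6 := cs.length_wordProd_le (ω.eraseIdx m)
    have h7 : m < ω.length := by simpa using hm
    rw [← h5, h2, hω.eq, List.length_eraseIdx_of_lt h7] at h6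
    omega

/-- The parity of the number of letters `i` is a homomorphism. -/
theorem exists_parity (hM : IsRightAngled M) (i : I) :
    ∃ χ : W →* ℤˣ, χ (cs.simple i) = -1 ∧ ∀ j ≠ i, χ (cs.simple j) = 1 := by
  classical
  have hl : M.IsLiftable (fun j => if j = i then (-1 : ℤˣ) else 1) := by
    intro a b
    by_cases hab : a = b
    · subst hab
      rw [← pow_two, Int.units_sq, one_pow]
    · rcases hM a b hab with h | h
      · rw [h]
        exact Int.units_sq _
      · rw [h, pow_zero]
  refine ⟨cs.lift ⟨_, hl⟩, ?_, ?_⟩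
  · rw [lift_apply_simple]; simp
  · intro j hj
    rw [lift_apply_simple]; simp [hj]

theorem simple_injective (hM : IsRightAngled M) : Function.Injective cs.simple := by
  intro i j h
  by_contra hij
  obtain ⟨χ, h1, h2⟩ := exists_parity cs hM i
  rw [h, h2 j (Ne.symm hij)] at h1
  exact absurd h1 (by decide)

theorem eq_of_simple_mul_eq_mul_simple (hM : IsRightAngled M) {w : W} {i k : I}
    (h : cs.simple i * w = w * cs.simple k) : i = k := by
  by_contra hik
  obtain ⟨χ, h1, h2⟩ := exists_parity cs hM i
  have h3 := congrArg χ h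
  rw [map_mul, map_mul, h1, h2 k (Ne.symm hik), mul_comm, mul_right_inj] at h3
  exact absurd h3 (by decide)

/-- For `m_ij = ∞`, killing all other generators maps `W` onto the infinite dihedral group. -/
theorem exists_toDihedral (hM : IsRightAngled M) {i j : I} (hij : i ≠ j) (h0 : M i j = 0) :
    ∃ φ : W →* DihedralGroup 0, φ (cs.simple i * cs.simple j) = DihedralGroup.r 1 ∧
      ∀ k, k ≠ i → k ≠ j → φ (cs.simple k) = 1 := by
  classical
  let f : I → DihedralGroup 0 := fun k =>
    if k = i then DihedralGroup.sr 0 else if k = j then DihedralGroup.sr 1 else 1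
  have hsq : ∀ a, f a * f a = 1 := by
    intro a
    simp only [f]
    split_ifs <;> simp
  have hl : M.IsLiftable f := by
    intro a b
    by_cases hab : a = b
    · subst hab
      simp [hsq]
    · rcases hM a b hab with h | h
      · rw [h]
        by_cases ha : a = i ∨ a = j
        · have hb : f b = 1 := by
            have hb1 : b ≠ i := by
              rintro rfl
              rcases ha with rfl | rfl
              · exact hab rfl
              · rw [M.symmetric] at h
                omega
            have hb2 : b ≠ j := by
              rintro rfl
              rcases ha with rfl | rfl
              · omega
              · exact hab rfl
            simp [f, hb1, hb2]
          rw [hb, mul_one, pow_two, hsq]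
        · have ha : f a = 1 := by
            push Not at ha
            simp [f, ha.1, ha.2]
          rw [ha, one_mul, pow_two, hsq]
      · rw [h, pow_zero]
  refine ⟨cs.lift ⟨f, hl⟩, ?_, ?_⟩
  · rw [map_mul, lift_apply_simple, lift_apply_simple]
    simp [f, Ne.symm hij]
  · intro k h1 h2
    rw [lift_apply_simple]
    simp [f, h1, h2]

theorem dihedral_r_one_zpow (n : ℤ) : (DihedralGroup.r 1 : DihedralGroup 0) ^ n =
    DihedralGroup.r n := by
  rw [DihedralGroup.r_zpow]
  congr 1
  rw [one_mul]
  exact Int.cast_id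

theorem zpow_simple_mul_simple_injective (hM : IsRightAngled M) {i j : I} (hij : i ≠ j)
    (h0 : M i j = 0) : Function.Injective fun n : ℤ => (cs.simple i * cs.simple j) ^ n := by
  intro m n h
  obtain ⟨φ, h1, -⟩ := exists_toDihedral cs hM hij h0
  have h2 := congrArg φ h
  simp only [map_zpow, h1] at h2
  rw [dihedral_r_one_zpow, dihedral_r_one_zpow] at h2
  exact DihedralGroup.r.inj h2

/-- The elements of the dihedral group `⟨s_i, s_j⟩`, as alternating words. -/
theorem exists_alternating {i j : I} {d : W}
    (hd : d ∈ Subgroup.closure {cs.simple i, cs.simple j}) :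
    ∃ n : ℕ, d = (cs.simple i * cs.simple j) ^ n ∨
      d = (cs.simple i * cs.simple j) ^ n * cs.simple i ∨
      d = (cs.simple j * cs.simple i) ^ n ∨ d = (cs.simple j * cs.simple i) ^ n * cs.simple j := by
  have hstep : ∀ a b : I, ∀ n : ℕ, ∃ m : ℕ,
      (cs.simple a * cs.simple b) ^ n * cs.simple b =
        (cs.simple a * cs.simple b) ^ m * cs.simple a ∨
      (cs.simple a * cs.simple b) ^ n * cs.simple b =
        (cs.simple b * cs.simple a) ^ m * cs.simple b := by
    intro a b n
    cases n with
    | zero => exact ⟨0, Or.inr (by simp)⟩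
    | succ n => exact ⟨n, Or.inl (by simp [pow_succ, mul_assoc])⟩
  have hmul : ∀ x : W, (∃ n : ℕ, x = (cs.simple i * cs.simple j) ^ n ∨
      x = (cs.simple i * cs.simple j) ^ n * cs.simple i ∨ x = (cs.simple j * cs.simple i) ^ n ∨
      x = (cs.simple j * cs.simple i) ^ n * cs.simple j) →
      ∀ y ∈ ({cs.simple i, cs.simple j} : Set W),
      ∃ n : ℕ, x * y = (cs.simple i * cs.simple j) ^ n ∨
      x * y = (cs.simple i * cs.simple j) ^ n * cs.simple i ∨
      x * y = (cs.simple j * cs.simple i) ^ n ∨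
      x * y = (cs.simple j * cs.simple i) ^ n * cs.simple j := by
    rintro x ⟨n, hx⟩ y (rfl | rfl)
    · rcases hx with rfl | rfl | rfl | rfl
      · exact ⟨n, Or.inr (Or.inl rfl)⟩
      · exact ⟨n, Or.inl (by simp)⟩
      · obtain ⟨m, h | h⟩ := hstep j i n
        · exact ⟨m, Or.inr (Or.inr (Or.inr h))⟩
        · exact ⟨m, Or.inr (Or.inl h)⟩
      · exact ⟨n + 1, Or.inr (Or.inr (Or.inl (by rw [pow_succ, mul_assoc])))⟩
    · rcases hx with rfl | rfl | rfl | rfl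
      · obtain ⟨m, h | h⟩ := hstep i j n
        · exact ⟨m, Or.inr (Or.inl h)⟩
        · exact ⟨m, Or.inr (Or.inr (Or.inr h))⟩
      · exact ⟨n + 1, Or.inl (by rw [pow_succ, mul_assoc])⟩
      · exact ⟨n, Or.inr (Or.inr (Or.inr rfl))⟩
      · exact ⟨n, Or.inr (Or.inr (Or.inl (by simp)))⟩
  induction hd using Subgroup.closure_induction_right with
  | one => exact ⟨0, Or.inl (by simp)⟩
  | mul_right x _ y hy ih => exact hmul x ih y hy
  | mul_inv_cancel x _ y hy ih =>
    have hy' : y⁻¹ = y := by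
      rcases hy with rfl | rfl <;> simp
    rw [hy']
    exact hmul x ih y hy

/-- If no reflection of `⟨s_i, s_j⟩` is an inversion of `z`, then no reflection `(s_i s_j)^m s_i`
with `m ≥ 0` is an inversion of `z (s_i s_j)^n`. -/
theorem crossing_mul_pow (hM : IsRightAngled M) {i j : I} (hij : i ≠ j) (h0 : M i j = 0) {z : W}
    (hz : ∀ m : ℕ, crossing cs hM z ((cs.simple i * cs.simple j) ^ m * cs.simple i) = 0)
    (n m : ℕ) : crossing cs hM (z * (cs.simple i * cs.simple j) ^ n)
      ((cs.simple i * cs.simple j) ^ m * cs.simple i) = 0 := by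
  classical
  have hinj := zpow_simple_mul_simple_injective cs hM hij h0
  have hne : ∀ k : ℕ, (cs.simple i * cs.simple j) ^ (k + 1) ≠ 1 := by
    intro k hk
    have := @hinj (k + 1) 0 (by simpa using mod_cast hk)
    omega
  induction n generalizing m with
  | zero => simpa using hz m
  | succ n ih =>
    rw [pow_succ, ← mul_assoc, crossing_mul]
    have h1 : cs.simple i * cs.simple j * ((cs.simple i * cs.simple j) ^ m * cs.simple i) *
        (cs.simple i * cs.simple j)⁻¹ = (cs.simple i * cs.simple j) ^ (m + 2) * cs.simple i := by
      rw [pow_succ (cs.simple i * cs.simple j) (m + 1), pow_succ' (cs.simple i * cs.simple j) m]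
      simp [mul_assoc]
    rw [h1, ih, add_zero, crossing_mul, crossing_simple, crossing_simple, if_neg, if_neg, add_zero]
    · intro h
      apply hne (m + 1)
      have h2 : cs.simple j * ((cs.simple i * cs.simple j) ^ m * cs.simple i) * cs.simple j =
          cs.simple i := by simpa using h
      have h3 := congrArg (fun x => cs.simple i * x) h2
      simp only [simple_mul_simple_self] at h3
      rw [← h3, pow_succ, pow_succ']
      simp only [mul_assoc]
    · intro h
      apply hne m
      rw [pow_succ, ← mul_assoc, h, simple_mul_simple_self]

/-- An element with two right descents `i ≠ j` has `m_ij ≠ ∞`. -/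
theorem ne_zero_of_descents (hM : IsRightAngled M) {i j : I} (hij : i ≠ j) {v : W}
    (hi : cs.length (v * cs.simple i) < cs.length v)
    (hj : cs.length (v * cs.simple j) < cs.length v) : M i j ≠ 0 := by
  classical
  intro h0
  have h0' : M j i = 0 := by rwa [M.symmetric]
  set D := Subgroup.closure {cs.simple i, cs.simple j} with hD
  have hiD : cs.simple i ∈ D := Subgroup.subset_closure (by simp)
  have hjD : cs.simple j ∈ D := Subgroup.subset_closure (by simp)
  -- a representative `v * b` of minimal length of the coset `v D` has no inversion in `D`
  obtain ⟨b, -, hb⟩ := (measure fun b : D => cs.length (v * b)).wf.has_min Set.univ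
    ⟨1, Set.mem_univ _⟩
  have hz : ∀ t ∈ D, crossing cs hM (v * b) t = 0 := by
    intro t ht
    by_contra h
    have h1 := length_mul_lt_of_crossing cs hM h
    refine hb (b * ⟨t, ht⟩) (Set.mem_univ _) ?_
    change cs.length (v * (b * t)) < cs.length (v * b)
    rwa [← mul_assoc]
  have hA : ∀ n m : ℕ, crossing cs hM (v * b * (cs.simple i * cs.simple j) ^ n)
      ((cs.simple i * cs.simple j) ^ m * cs.simple i) = 0 :=
    crossing_mul_pow cs hM hij h0 fun m => hz _ (mul_mem (pow_mem (mul_mem hiD hjD) m) hiD)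
  have hB : ∀ n m : ℕ, crossing cs hM (v * b * (cs.simple j * cs.simple i) ^ n)
      ((cs.simple j * cs.simple i) ^ m * cs.simple j) = 0 :=
    crossing_mul_pow cs hM hij.symm h0' fun m => hz _ (mul_mem (pow_mem (mul_mem hjD hiD) m) hjD)
  have hi' := crossing_of_length_mul_lt cs hM hi
  have hj' := crossing_of_length_mul_lt cs hM hj
  have hsi : cs.simple i ≠ cs.simple j := (simple_injective cs hM).ne hij
  obtain ⟨n, h⟩ := exists_alternating cs (i := i) (j := j) (inv_mem b.2)
  have hv : v = v * b * (b : W)⁻¹ := by group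
  rcases h with h | h | h | h
  · apply hi'
    rw [hv, h]
    simpa using hA n 0
  · apply hj'
    rw [hv, h, ← mul_assoc, crossing_mul, crossing_simple, if_neg hsi.symm, zero_add]
    simpa using hA n 1
  · apply hj'
    rw [hv, h]
    simpa using hB n 0
  · apply hi'
    rw [hv, h, ← mul_assoc, crossing_mul, crossing_simple, if_neg hsi, zero_add]
    simpa using hB n 1

/-- Two distinct right descents of `w s_i`, one of them being `i`, commute. -/
theorem descent_commute (hM : IsRightAngled M) {i j : I} (hij : i ≠ j) {w : W}
    (h1 : cs.length (w * cs.simple i) = cs.length w + 1)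
    (h2 : cs.length (w * cs.simple i * cs.simple j) < cs.length (w * cs.simple i)) :
    M i j = 2 ∧ cs.length (w * cs.simple j) < cs.length w := by
  have hm : M i j = 2 := by
    refine (hM i j hij).resolve_right (ne_zero_of_descents cs hM hij ?_ h2)
    rw [simple_mul_simple_cancel_right]
    omega
  refine ⟨hm, ?_⟩
  classical
  have h3 := crossing_of_length_mul_lt cs hM h2
  rw [crossing_mul, crossing_simple, if_neg ((simple_injective cs hM).ne hij.symm), zero_add,
    commute_simple cs hm, mul_inv_cancel_right] at h3
  exact length_mul_lt_of_crossing cs hM h3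

/-- If `s_i` commutes with `w` and is not a descent of it, then so it does with every right
descent of `w`, and the situation is inherited by the shortened element. -/
theorem descent_of_commute (hM : IsRightAngled M) {i j : I} {w : W}
    (hc : cs.simple i * w = w * cs.simple i)
    (h1 : cs.length (w * cs.simple i) = cs.length w + 1)
    (h2 : cs.length (w * cs.simple j) < cs.length w) :
    M i j = 2 ∧ cs.simple i * (w * cs.simple j) = w * cs.simple j * cs.simple i ∧
      cs.length (w * cs.simple j * cs.simple i) = cs.length (w * cs.simple j) + 1 := by
  have hij : i ≠ j := by
    rintro rfl
    omega
  have h3 : cs.length (w * cs.simple i * cs.simple j) < cs.length (w * cs.simple i) := by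
    have h4 := cs.length_simple_mul (w * cs.simple j) i
    rw [← mul_assoc, hc] at h4
    omega
  have hm := (descent_commute cs hM hij h1 h3).1
  have hcomm := commute_simple cs hm
  have h5 := cs.length_mul_simple (w * cs.simple i) j
  have h6 := cs.length_mul_simple w j
  have h7 : w * cs.simple j * cs.simple i = w * cs.simple i * cs.simple j := by
    rw [mul_assoc, ← hcomm, mul_assoc]
  refine ⟨hm, ?_, ?_⟩
  · rw [h7, ← mul_assoc, hc]
  · rw [h7]
    omega

end Coxeter
section Gen

variable {I : Type*} (M : CoxeterMatrix I)

theorem gen_mul_gen (i : I) : gen M i * gen M i = 1 := M.toCoxeterSystem.simple_mul_simple_self i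

theorem mul_gen_mul_gen (w : M.Group) (i : I) : w * gen M i * gen M i = w :=
  M.toCoxeterSystem.simple_mul_simple_cancel_right i

theorem gen_mul_gen_mul (w : M.Group) (i : I) : gen M i * (gen M i * w) = w :=
  M.toCoxeterSystem.simple_mul_simple_cancel_left i

theorem gen_inv (i : I) : (gen M i)⁻¹ = gen M i := M.toCoxeterSystem.inv_simple i

theorem len_one : len M 1 = 0 := M.toCoxeterSystem.length_one

theorem len_inv (w : M.Group) : len M w⁻¹ = len M w := M.toCoxeterSystem.length_inv w

theorem len_gen (i : I) : len M (gen M i) = 1 := M.toCoxeterSystem.length_simple i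

theorem gen_ne_one (i : I) : gen M i ≠ 1 := by
  intro h
  have := len_gen M i
  rw [h, len_one] at this
  omega

theorem len_mul_gen (w : M.Group) (i : I) :
    len M (w * gen M i) = len M w + 1 ∨ len M (w * gen M i) + 1 = len M w :=
  M.toCoxeterSystem.length_mul_simple w i

theorem len_gen_mul (w : M.Group) (i : I) :
    len M (gen M i * w) = len M w + 1 ∨ len M (gen M i * w) + 1 = len M w :=
  M.toCoxeterSystem.length_simple_mul w i

theorem mem_parabolic_singleton {i : I} {w : M.Group} :
    w ∈ parabolic M {i} ↔ w = 1 ∨ w = gen M i := by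
  rw [parabolic, Set.image_singleton, Subgroup.mem_closure_singleton]
  constructor
  · rintro ⟨n, rfl⟩
    rcases Int.even_or_odd' n with ⟨k, rfl | rfl⟩
    · left
      rw [zpow_mul, zpow_two, gen_mul_gen, one_zpow]
    · right
      rw [zpow_add, zpow_mul, zpow_two, gen_mul_gen, one_zpow, one_mul, zpow_one]
  · rintro (rfl | rfl)
    · exact ⟨0, zpow_zero _⟩
    · exact ⟨1, zpow_one _⟩

end Gen

namespace Building

/-! ### Weyl distance and panels -/

variable {I : Type*} {M : CoxeterMatrix I} {Δ : Type*} (B : Building M Δ)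

theorem δ_self (c : Δ) : B.δ c c = 1 := (B.δ_eq_one_iff c c).2 rfl

theorem δ_gen_symm {c d : Δ} {i : I} (h : B.δ c d = gen M i) : B.δ d c = gen M i := by
  have h1 := (B.δ_adjacent d c c i h).1
  rw [δ_self] at h1
  rcases h1 with h1 | h1
  · have h2 := congrArg (gen M i * ·) h1
    simpa [gen_mul_gen_mul] using h2.symm
  · rw [eq_comm, δ_eq_one_iff] at h1
    subst h1
    rw [δ_self] at h
    exact absurd h.symm (gen_ne_one M i)

/-- The first axiom on adjacent chambers, for a step at the end of the gallery and not at its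
beginning. -/
theorem δ_right_of_len {c d d' : Δ} {i : I} (hd : B.δ d d' = gen M i)
    (hl : len M (B.δ c d * gen M i) = len M (B.δ c d) + 1) :
    B.δ c d' = B.δ c d * gen M i := by
  induction hn : len M (B.δ c d) generalizing c with
  | zero =>
    have h1 : B.δ c d = 1 := M.toCoxeterSystem.length_eq_zero_iff.1 hn
    obtain rfl := (B.δ_eq_one_iff c d).1 h1
    rw [δ_self, one_mul, hd]
  | succ n ih =>
    have hne : B.δ c d ≠ 1 := by
      intro h
      rw [h, len_one] at hn
      omega
    obtain ⟨j, hj⟩ := M.toCoxeterSystem.exists_leftDescent_of_ne_one hne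
    have hj' : len M (gen M j * B.δ c d) < len M (B.δ c d) := hj
    obtain ⟨c1, hc1, hc1d⟩ := B.exists_adjacent c d j
    have h1 := len_gen_mul M (B.δ c d) j
    have h2 := len_gen_mul M (B.δ c d * gen M i) j
    have h3 := len_mul_gen M (gen M j * B.δ c d) i
    rw [mul_assoc] at h3
    have h4 := ih (c := c1) (by rw [hc1d, mul_assoc]; omega) (by rw [hc1d]; omega)
    have h5 := (B.δ_adjacent c1 d' c j (B.δ_gen_symm hc1)).2
    rw [h4, hc1d, mul_assoc, gen_mul_gen_mul] at h5
    exact h5 (by omega)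

theorem δ_inv (c d : Δ) : B.δ d c = (B.δ c d)⁻¹ := by
  induction hn : len M (B.δ c d) generalizing c with
  | zero =>
    have h1 : B.δ c d = 1 := M.toCoxeterSystem.length_eq_zero_iff.1 hn
    rw [h1]
    obtain rfl := (B.δ_eq_one_iff c d).1 h1
    rw [δ_self, inv_one]
  | succ n ih =>
    have hne : B.δ c d ≠ 1 := by
      intro h
      rw [h, len_one] at hn
      omega
    obtain ⟨j, hj⟩ := M.toCoxeterSystem.exists_leftDescent_of_ne_one hne
    have hj' : len M (gen M j * B.δ c d) < len M (B.δ c d) := hj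
    obtain ⟨c1, hc1, hc1d⟩ := B.exists_adjacent c d j
    have h1 := len_gen_mul M (B.δ c d) j
    have h4 := ih c1 (by rw [hc1d]; omega)
    rw [hc1d, mul_inv_rev, gen_inv] at h4
    have h5 := B.δ_right_of_len (c := d) hc1 (by
      rw [h4, mul_gen_mul_gen, ← gen_inv M j, ← mul_inv_rev, len_inv, len_inv]
      omega)
    rw [h5, h4, mul_gen_mul_gen]

theorem δ_right {c d d' : Δ} {i : I} (hd : B.δ d d' = gen M i) :
    B.δ c d' = B.δ c d * gen M i ∨ B.δ c d' = B.δ c d := by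
  have h := (B.δ_adjacent d c d' i (B.δ_gen_symm hd)).1
  rw [B.δ_inv c d', B.δ_inv c d] at h
  rcases h with h | h
  · left
    rw [← inv_inv (B.δ c d'), h, mul_inv_rev, inv_inv, gen_inv]
  · exact Or.inr (inv_injective h)

theorem exists_adjacent_right (c d : Δ) (i : I) :
    ∃ d', B.δ d d' = gen M i ∧ B.δ c d' = B.δ c d * gen M i := by
  obtain ⟨d', h1, h2⟩ := B.exists_adjacent d c i
  refine ⟨d', B.δ_gen_symm h1, ?_⟩
  rw [B.δ_inv d' c, h2, B.δ_inv c d, mul_inv_rev, inv_inv, gen_inv]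

/-- Chambers are connected by galleries. -/
theorem gallery_induction (c : Δ) {p : Δ → Prop} (hc : p c)
    (hs : ∀ x y i, p x → B.δ x y = gen M i → p y) (d : Δ) : p d := by
  induction hn : len M (B.δ c d) generalizing d with
  | zero =>
    have h1 : B.δ c d = 1 := M.toCoxeterSystem.length_eq_zero_iff.1 hn
    obtain rfl := (B.δ_eq_one_iff c d).1 h1
    exact hc
  | succ n ih =>
    have hne : B.δ c d ≠ 1 := by
      intro h
      rw [h, len_one] at hn
      omega
    obtain ⟨j, hj⟩ := M.toCoxeterSystem.exists_rightDescent_of_ne_one hne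
    have hj' : len M (B.δ c d * gen M j) < len M (B.δ c d) := hj
    obtain ⟨d1, hd1, hcd1⟩ := B.exists_adjacent_right c d j
    have h1 := len_mul_gen M (B.δ c d) j
    exact hs d1 d j (ih d1 (by rw [hcd1]; omega)) (B.δ_gen_symm hd1)

/-- `i`-equivalence of chambers: being in the same `i`-panel. -/
def Adj (i : I) (c d : Δ) : Prop := c = d ∨ B.δ c d = gen M i

variable {B}

theorem Adj.refl {i : I} (c : Δ) : B.Adj i c c := Or.inl rfl

theorem Adj.symm {i : I} {c d : Δ} (h : B.Adj i c d) : B.Adj i d c :=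
  h.imp Eq.symm B.δ_gen_symm

theorem Adj.trans {i : I} {c d e : Δ} (h : B.Adj i c d) (h' : B.Adj i d e) : B.Adj i c e := by
  rcases h with rfl | h
  · exact h'
  rcases h' with rfl | h'
  · exact Or.inr h
  rcases B.δ_right (c := c) h' with h1 | h1
  · rw [h, gen_mul_gen, δ_eq_one_iff] at h1
    exact Or.inl h1
  · exact Or.inr (h1.trans h)

theorem Adj.image {i : I} {c d : Δ} (h : B.Adj i c d) (g : B.Aut) : B.Adj i (g.1 c) (g.1 d) :=
  h.imp (congrArg _) fun h => by rw [Aut.δ_eq, h]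

theorem Adj.δ_eq {i : I} {c d : Δ} (h : B.Adj i c d) (hne : c ≠ d) : B.δ c d = gen M i :=
  h.resolve_left hne

variable (B)

/-- The `i`-panel of a chamber. -/
def panelOf (i : I) (c : Δ) : B.Panel i := ⟨{d | B.δ c d ∈ parabolic M {i}}, c, rfl⟩

variable {B}

theorem mem_panelOf {i : I} {c d : Δ} : d ∈ (B.panelOf i c).1 ↔ B.Adj i c d := by
  change B.δ c d ∈ parabolic M {i} ↔ _
  rw [mem_parabolic_singleton, δ_eq_one_iff, Adj]

theorem Panel.eq_panelOf {i : I} (P : B.Panel i) {c : Δ} (hc : c ∈ P.1) : P = B.panelOf i c := by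
  obtain ⟨P, e, rfl⟩ := P
  have hc' : B.Adj i e c := mem_panelOf.1 hc
  refine Subtype.ext (Set.ext fun d => ?_)
  change d ∈ (B.panelOf i e).1 ↔ _
  rw [mem_panelOf, mem_panelOf]
  exact ⟨hc'.symm.trans, hc'.trans⟩

theorem Panel.nonempty {i : I} (P : B.Panel i) : ∃ c, c ∈ P.1 := by
  obtain ⟨P, e, rfl⟩ := P
  exact ⟨e, (mem_panelOf (i := i)).2 (Adj.refl e)⟩

theorem Panel.adj {i : I} (P : B.Panel i) {c d : Δ} (hc : c ∈ P.1) (hd : d ∈ P.1) :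
    B.Adj i c d := by
  rw [P.eq_panelOf hc] at hd
  exact mem_panelOf.1 hd

theorem Panel.mem_of_adj {i : I} (P : B.Panel i) {c d : Δ} (hc : c ∈ P.1) (hd : B.Adj i c d) :
    d ∈ P.1 := by
  rw [P.eq_panelOf hc]
  exact mem_panelOf.2 hd

theorem Panel.eq_of_mem {i : I} {P Q : B.Panel i} {c : Δ} (hP : c ∈ P.1) (hQ : c ∈ Q.1) :
    P = Q := by
  rw [P.eq_panelOf hP, Q.eq_panelOf hQ]

theorem mem_panelOf_self (i : I) (c : Δ) : c ∈ (B.panelOf i c).1 := mem_panelOf.2 (Adj.refl c)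

/-- Galleries of commuting types `i`, `j` complete to squares. -/
theorem exists_square (hM : IsRightAngled M) {i j : I} (hm : M i j = 2) {x y z : Δ}
    (hxy : B.δ x y = gen M i) (hyz : B.δ y z = gen M j) :
    ∃ y', B.δ x y' = gen M j ∧ B.δ y' z = gen M i := by
  have hij : i ≠ j := by
    rintro rfl
    simp at hm
  have hcomm : gen M i * gen M j = gen M j * gen M i := commute_simple M.toCoxeterSystem hm
  obtain ⟨y', h1, h2⟩ := B.exists_adjacent x z j
  refine ⟨y', B.δ_gen_symm h1, ?_⟩
  rw [h2]
  rcases B.δ_right (c := x) hyz with h | h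
  · rw [h, hxy, hcomm, gen_mul_gen_mul]
  · exfalso
    have h3 : B.Adj i y z :=
      Adj.trans (Or.inr (B.δ_gen_symm hxy)) (Or.inr (h.trans hxy))
    rcases h3 with rfl | h3
    · rw [δ_self] at hyz
      exact gen_ne_one M j hyz.symm
    · exact hij (simple_injective M.toCoxeterSystem hM (h3.symm.trans hyz))

theorem exists_square_adj (hM : IsRightAngled M) {i j : I} (hm : M i j = 2) {x y z : Δ}
    (hxy : B.Adj i x y) (hyz : B.Adj j y z) : ∃ y', B.Adj j x y' ∧ B.Adj i y' z := by
  rcases hxy with rfl | hxy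
  · exact ⟨z, hyz, Adj.refl z⟩
  rcases hyz with rfl | hyz
  · exact ⟨x, Adj.refl x, Or.inr hxy⟩
  obtain ⟨y', h1, h2⟩ := exists_square hM hm hxy hyz
  exact ⟨y', Or.inr h1, Or.inr h2⟩

end Building

namespace LegalColoring

open Building

variable {I : Type*} {M : CoxeterMatrix I} {Δ : Type*} {B : Building M Δ} {Ω : I → Type*}
  (col : LegalColoring B Ω)

theorem color_eq_of_adj {i j : I} (hji : j ≠ i) {c d : Δ} (h : B.Adj i c d) :
    col.color j c = col.color j d :=
  col.const i j (B.panelOf i c) hji c (mem_panelOf_self i c) d (mem_panelOf.2 h)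

theorem eq_of_adj {i : I} {c d : Δ} (h : B.Adj i c d) (hc : col.color i c = col.color i d) :
    c = d := by
  have := @(col.bij i (B.panelOf i c)).1 ⟨c, mem_panelOf_self i c⟩ ⟨d, mem_panelOf.2 h⟩ hc
  exact congrArg Subtype.val this

theorem exists_adj_color {i : I} (c : Δ) (a : Ω i) : ∃ d, B.Adj i c d ∧ col.color i d = a := by
  obtain ⟨d, hd, h⟩ := col.exists_color (B.panelOf i c) a
  exact ⟨d, mem_panelOf.1 hd, h⟩

end LegalColoring
namespace LegalColoring

open Building

variable {I : Type*} {M : CoxeterMatrix I} {Δ : Type*} {B : Building M Δ} {Ω : I → Type*}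

/-! ### Automorphisms from colorings -/

/-- The chambers `x` and `y` have the same colors, `x` with respect to `col'` and `y` with respect
to `col`. -/
def SameColors (col col' : LegalColoring B Ω) (x y : Δ) : Prop :=
  ∀ k, col'.color k x = col.color k y

/-- Pairs of chambers reached from `(c, d)` by two minimal galleries of the same type with the same
colors. -/
inductive MinimalPair (col col' : LegalColoring B Ω) (c d : Δ) : Δ → Δ → Prop
  | base : MinimalPair col col' c d c d
  | step {x y x' y' : Δ} {i : I} (h : MinimalPair col col' c d x y)
      (hl : len M (B.δ c x * gen M i) = len M (B.δ c x) + 1)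
      (hx : B.δ x x' = gen M i) (hy : B.δ y y' = gen M i) (hc : SameColors col col' x' y') :
      MinimalPair col col' c d x' y'

variable {col col' : LegalColoring B Ω}

theorem SameColors.eq_of_adj {i : I} {x y x' y' : Δ} (h : SameColors col col' x y)
    (h' : SameColors col col' x' y') (hy : B.Adj i y y') (hx : x = x') : y = y' := by
  subst hx
  exact col.eq_of_adj hy ((h i).symm.trans (h' i))

theorem SameColors.eq_of_adj' {i : I} {x y x' y' : Δ} (h : SameColors col col' x y)
    (h' : SameColors col col' x' y') (hx : B.Adj i x x') (hy : y = y') : x = x' := by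
  subst hy
  exact col'.eq_of_adj hx ((h i).trans (h' i).symm)

namespace MinimalPair

variable {c d x y : Δ}

theorem sameColors (hcd : SameColors col col' c d) (h : MinimalPair col col' c d x y) :
    SameColors col col' x y := by
  cases h with
  | base => exact hcd
  | step _ _ _ _ hc => exact hc

theorem δ_eq (h : MinimalPair col col' c d x y) : B.δ c x = B.δ d y := by
  induction h with
  | base => rw [δ_self, δ_self]
  | step _ hl hx hy _ ih =>
    rw [B.δ_right_of_len hx hl, B.δ_right_of_len hy (by rwa [ih] at hl), ih]

/-- The last steps of the minimal galleries to `(x, y)` can be chosen of any type `j` that is a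
right descent of the Weyl distance: two descents commute, so the steps can be interchanged. -/
theorem exists_of_descent (hM : IsRightAngled M) (hcd : SameColors col col' c d)
    (h : MinimalPair col col' c d x y) {j : I}
    (hj : len M (B.δ c x * gen M j) < len M (B.δ c x)) :
    ∃ x₁ y₁, MinimalPair col col' c d x₁ y₁ ∧ B.δ x₁ x = gen M j ∧ B.δ y₁ y = gen M j ∧
      B.δ c x₁ = B.δ c x * gen M j := by
  induction h with
  | base =>
    rw [δ_self, one_mul, len_one] at hj
    omega
  | @step x y x' y' i h hl hx hy hc ih =>
    have hx' := B.δ_right_of_len hx hl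
    rw [hx'] at hj ⊢
    by_cases hij : i = j
    · subst hij
      exact ⟨x, y, h, hx, hy, (mul_gen_mul_gen M _ i).symm⟩
    obtain ⟨hm, hj1⟩ := descent_commute M.toCoxeterSystem hM hij hl hj
    have hcomm : gen M i * gen M j = gen M j * gen M i := commute_simple M.toCoxeterSystem hm
    obtain ⟨x₁, y₁, h1, hx1, hy1, hcx1⟩ := ih hj1
    have hm' : M j i = 2 := by rwa [M.symmetric]
    obtain ⟨x₂, hx2, hx3⟩ := exists_square hM hm' hx1 hx
    obtain ⟨y₂, hy2, hy3⟩ := exists_square hM hm' hy1 hy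
    have hl1 : len M (B.δ c x₁ * gen M i) = len M (B.δ c x₁) + 1 := by
      have h2 := len_mul_gen M (B.δ c x * gen M i) j
      have h3 := len_mul_gen M (B.δ c x) j
      have hj1' : len M (B.δ c x * gen M j) < len M (B.δ c x) := hj1
      rw [hcx1, mul_assoc, ← hcomm, ← mul_assoc]
      omega
    refine ⟨x₂, y₂, h1.step hl1 hx2 hy2 ?_, hx3, hy3, ?_⟩
    · intro k
      by_cases hk : k = i
      · subst hk
        rw [col'.color_eq_of_adj hij (Or.inr hx3), col.color_eq_of_adj hij (Or.inr hy3)]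
        exact hc k
      · rw [← col'.color_eq_of_adj hk (Or.inr hx2), ← col.color_eq_of_adj hk (Or.inr hy2)]
        exact h1.sameColors hcd k
    · rw [B.δ_right_of_len hx2 hl1, hcx1, mul_assoc, ← hcomm, ← mul_assoc]

theorem of_adj (hM : IsRightAngled M) (hcd : SameColors col col' c d)
    (h : MinimalPair col col' c d x y) {i : I} {x' y' : Δ} (hx : B.Adj i x x')
    (hy : B.Adj i y y') (hc : SameColors col col' x' y') : MinimalPair col col' c d x' y' := by
  have hxy := h.sameColors hcd
  by_cases hxx : x = x'
  · obtain rfl := hxy.eq_of_adj hc hy hxx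
    rwa [← hxx]
  have hyy : y ≠ y' := fun e => hxx (hxy.eq_of_adj' hc hx e)
  rcases len_mul_gen M (B.δ c x) i with hl | hl
  · exact h.step hl (hx.δ_eq hxx) (hy.δ_eq hyy) hc
  · obtain ⟨x₁, y₁, h1, hx1, hy1, hcx⟩ := h.exists_of_descent hM hcd (j := i) (by omega)
    have hxy1 := h1.sameColors hcd
    have hx' : B.Adj i x₁ x' := Adj.trans (Or.inr hx1) hx
    have hy' : B.Adj i y₁ y' := Adj.trans (Or.inr hy1) hy
    by_cases hxx1 : x₁ = x'
    · obtain rfl := hxy1.eq_of_adj hc hy' hxx1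
      rwa [← hxx1]
    have hyy1 : y₁ ≠ y' := fun e => hxx1 (hxy1.eq_of_adj' hc hx' e)
    refine h1.step ?_ (hx'.δ_eq hxx1) (hy'.δ_eq hyy1) hc
    rw [hcx, mul_gen_mul_gen]
    omega

end MinimalPair

/-- Simultaneous steps of the same type, with matching colors, in the two coordinates. -/
def PairStep (col col' : LegalColoring B Ω) (p q : Δ × Δ) : Prop :=
  SameColors col col' p.1 p.2 ∧ SameColors col col' q.1 q.2 ∧
    ∃ i, B.Adj i p.1 q.1 ∧ B.Adj i p.2 q.2

theorem PairStep.symm {p q : Δ × Δ} (h : PairStep col col' p q) : PairStep col col' q p := by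
  obtain ⟨h1, h2, i, h3, h4⟩ := h
  exact ⟨h2, h1, i, h3.symm, h4.symm⟩

theorem δ_eq_of_pairStep (hM : IsRightAngled M) {p q : Δ × Δ}
    (hp : SameColors col col' p.1 p.2) (h : Relation.ReflTransGen (PairStep col col') p q) :
    B.δ p.1 q.1 = B.δ p.2 q.2 := by
  have key : MinimalPair col col' p.1 p.2 q.1 q.2 := by
    induction h with
    | refl => exact MinimalPair.base
    | tail _ hs ih =>
      obtain ⟨-, h2, i, h3, h4⟩ := hs
      exact ih.of_adj hM hp h3 h4 h2
  exact key.δ_eq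

/-- Any two legal colorings are conjugate under an automorphism with prescribed image of one
chamber. -/
theorem exists_aut_of_sameColors (hM : IsRightAngled M) {c d : Δ}
    (hcd : SameColors col col' c d) :
    ∃ u : B.Aut, u.1 c = d ∧ ∀ x, SameColors col col' x (u.1 x) := by
  have : Std.Symm (PairStep col col') := ⟨fun _ _ => PairStep.symm⟩
  have hcol : ∀ q, Relation.ReflTransGen (PairStep col col') (c, d) q →
      SameColors col col' q.1 q.2 := by
    intro q h
    cases h with
    | refl => exact hcd
    | tail _ hs => exact hs.2.1
  have hiso : ∀ p q, Relation.ReflTransGen (PairStep col col') (c, d) p →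
      Relation.ReflTransGen (PairStep col col') (c, d) q → B.δ p.1 q.1 = B.δ p.2 q.2 := by
    intro p q hp hq
    exact δ_eq_of_pairStep hM (hcol p hp)
      ((Relation.ReflTransGen.stdSymm.symm _ _ hp).trans hq)
  have hleft : ∀ x, ∃ y, Relation.ReflTransGen (PairStep col col') (c, d) (x, y) := by
    refine B.gallery_induction c ⟨d, .refl⟩ ?_
    rintro x x' i ⟨y, hy⟩ hx
    obtain ⟨y', hy', hc⟩ := col.exists_adj_color (i := i) y (col'.color i x')
    refine ⟨y', hy.tail ⟨hcol _ hy, ?_, i, Or.inr hx, hy'⟩⟩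
    intro k
    by_cases hk : k = i
    · subst hk
      exact hc.symm
    · exact ((col'.color_eq_of_adj hk (Or.inr hx)).symm.trans (hcol _ hy k)).trans
        (col.color_eq_of_adj hk hy')
  have hright : ∀ y, ∃ x, Relation.ReflTransGen (PairStep col col') (c, d) (x, y) := by
    refine B.gallery_induction d ⟨c, .refl⟩ ?_
    rintro y y' i ⟨x, hx⟩ hy
    obtain ⟨x', hx', hc⟩ := col'.exists_adj_color (i := i) x (col.color i y')
    refine ⟨x', hx.tail ⟨hcol _ hx, ?_, i, hx', Or.inr hy⟩⟩
    intro k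
    by_cases hk : k = i
    · subst hk
      exact hc
    · exact ((col'.color_eq_of_adj hk hx').symm.trans (hcol _ hx k)).trans
        (col.color_eq_of_adj hk (Or.inr hy))
  choose u hu using hleft
  have huδ : ∀ x x', B.δ (u x) (u x') = B.δ x x' := fun x x' => (hiso _ _ (hu x) (hu x')).symm
  have heq : ∀ x y, Relation.ReflTransGen (PairStep col col') (c, d) (x, y) → u x = y := by
    intro x y h
    rw [← B.δ_eq_one_iff, ← hiso _ _ (hu x) h, δ_self]
  have hbij : Function.Bijective u := by
    constructor
    · intro x x' h
      rw [← B.δ_eq_one_iff, ← huδ, h, δ_self]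
    · intro y
      obtain ⟨x, hx⟩ := hright y
      exact ⟨x, heq x y hx⟩
  exact ⟨⟨Equiv.ofBijective u hbij, huδ⟩, heq c d .refl, fun x => hcol _ (hu x)⟩

/-- Colors `μ` that are constant where legal colorings are, and that differ from the `j`-color by a
permutation on each `j`-panel, form a legal coloring; an automorphism carries it to `col`. -/
theorem exists_aut (col : LegalColoring B Ω) (hM : IsRightAngled M) (μ : ∀ j, Δ → Ω j)
    (hconst : ∀ (j k : I) (x y : Δ), j ≠ k → B.Adj k x y → μ j x = μ j y)
    (hperm : ∀ (j : I) (Q : B.Panel j), ∃ π : Equiv.Perm (Ω j), ∀ x ∈ Q.1,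
      μ j x = π (col.color j x))
    {c d : Δ} (hcd : ∀ j, μ j c = col.color j d) :
    ∃ u : B.Aut, u.1 c = d ∧ ∀ j x, col.color j (u.1 x) = μ j x := by
  let col' : LegalColoring B Ω :=
    { color := μ
      bij := by
        intro i P
        obtain ⟨π, hπ⟩ := hperm i P
        have : (fun c : P.1 => μ i c.1) = π ∘ fun c : P.1 => col.color i c.1 := by
          funext x
          exact hπ x.1 x.2
        rw [this]
        exact π.bijective.comp (col.bij i P)
      const := fun i j P hji x hx y hy => hconst j i x y hji (P.adj hx hy) }
  obtain ⟨u, hu, h⟩ := exists_aut_of_sameColors (col := col) (col' := col') hM hcd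
  exact ⟨u, hu, fun j x => (h x j).symm⟩

end LegalColoring
namespace Building

variable {I : Type*} {M : CoxeterMatrix I} {Δ : Type*} {B : Building M Δ} {Ω : I → Type*}

/-! ### Galleries with types in a given set -/

variable (B) in
/-- `c` and `d` are joined by a gallery with types in `J`, i.e. lie in the same `J`-residue. -/
def Joined (J : Set I) : Δ → Δ → Prop :=
  Relation.ReflTransGen fun x y => ∃ j ∈ J, B.Adj j x y

theorem Joined.symm {J : Set I} {c d : Δ} (h : B.Joined J c d) : B.Joined J d c := by
  have : Std.Symm fun x y => ∃ j ∈ J, B.Adj j x y :=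
    ⟨fun _ _ ⟨j, hj, h⟩ => ⟨j, hj, h.symm⟩⟩
  exact Relation.ReflTransGen.stdSymm.symm _ _ h

theorem Joined.image {J : Set I} {c d : Δ} (h : B.Joined J c d) (g : B.Aut) :
    B.Joined J (g.1 c) (g.1 d) :=
  Relation.ReflTransGen.lift g.1 (fun _ _ ⟨j, hj, h⟩ => ⟨j, hj, h.image g⟩) _ _ h

theorem Joined.exists_adj (hM : IsRightAngled M) {J : Set I} {i : I} (hJ : ∀ j ∈ J, M i j = 2)
    {c c' d : Δ} (h : B.Joined J c d) (hc : B.Adj i c c') :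
    ∃ d', B.Adj i d d' ∧ B.Joined J c' d' := by
  induction h with
  | refl => exact ⟨c', hc, .refl⟩
  | tail _ hs ih =>
    obtain ⟨d', hd', hj⟩ := ih
    obtain ⟨j, hjJ, hs⟩ := hs
    obtain ⟨e, h1, h2⟩ := exists_square_adj hM (hJ j hjJ) hd'.symm hs
    exact ⟨e, h2.symm, hj.tail ⟨j, hjJ, h1⟩⟩

theorem Joined.color_eq (col : LegalColoring B Ω) {J : Set I} {i : I} (hi : i ∉ J) {c d : Δ}
    (h : B.Joined J c d) : col.color i c = col.color i d := by
  induction h with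
  | refl => rfl
  | tail _ hs ih =>
    obtain ⟨j, hjJ, hs⟩ := hs
    exact ih.trans (col.color_eq_of_adj (i := j) (j := i) (fun e => hi (e ▸ hjJ)) hs)

theorem finite_adj (col : LegalColoring B Ω) (i : I) [Finite (Ω i)] (c : Δ) :
    {d | B.Adj i c d}.Finite := by
  refine Set.Finite.of_finite_image (f := col.color i) (Set.toFinite _) ?_
  intro x hx y hy hxy
  exact col.eq_of_adj (Adj.trans (Adj.symm hx) hy) hxy

/-- A residue whose types commute pairwise is finite. -/
theorem finite_joined (hM : IsRightAngled M) (col : LegalColoring B Ω) [∀ i, Finite (Ω i)]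
    (J : Finset I) (hJ : ∀ j ∈ J, ∀ k ∈ J, j ≠ k → M j k = 2) (c : Δ) :
    {d | B.Joined J c d}.Finite := by
  classical
  induction J using Finset.induction_on generalizing c with
  | empty =>
    refine (Set.finite_singleton c).subset ?_
    intro d hd
    induction (show B.Joined _ c d from hd) with
    | refl => rfl
    | tail _ hs => simp at hs
  | insert j J hj ih =>
    have hJ' : ∀ k ∈ J, M j k = 2 := fun k hk =>
      hJ j (Finset.mem_insert_self j J) k (Finset.mem_insert_of_mem hk) fun e => hj (e ▸ hk)
    refine ((finite_adj col j c).biUnion fun c' _ => ih (fun k hk l hl => hJ k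
      (Finset.mem_insert_of_mem hk) l (Finset.mem_insert_of_mem hl)) c').subset ?_
    intro d hd
    simp only [Set.mem_iUnion]
    induction (show B.Joined _ c d from hd) with
    | refl => exact ⟨c, Adj.refl c, .refl⟩
    | tail hp hs ih2 =>
      obtain ⟨c', hc', hj'⟩ := ih2 hp
      obtain ⟨k, hk, hs⟩ := hs
      have hj'' : B.Joined J c' _ := hj'
      rcases Finset.mem_insert.1 (Finset.mem_coe.1 hk) with rfl | hk
      · -- a step of type `j` is moved to the beginning of the gallery
        obtain ⟨c'', h1, h2⟩ := hj''.symm.exists_adj hM hJ' hs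
        exact ⟨c'', Adj.trans hc' h1, h2.symm⟩
      · exact ⟨c', hc', hj''.tail ⟨k, hk, hs⟩⟩

/-! ### Parallel panels -/

/-- The types orthogonal to `i`. -/
def perp (M : CoxeterMatrix I) (i : I) : Set I := {j | M i j = 2}

theorem notMem_perp (i : I) : i ∉ perp M i := by
  simp [perp]

theorem localAction_eq_of_joined (hM : IsRightAngled M) (col : LegalColoring B Ω) {i : I}
    {P Q : B.Panel i} {c d : Δ} (hc : c ∈ P.1) (hd : d ∈ Q.1) (h : B.Joined (perp M i) c d)
    (g : B.Aut) : col.localAction g Q = col.localAction g P := by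
  ext a
  obtain ⟨c', hc', rfl⟩ := col.exists_color P a
  obtain ⟨d', hd', h'⟩ := h.exists_adj hM (fun _ hj => hj) (P.adj hc hc')
  rw [col.localAction_color g P hc', h'.color_eq col (notMem_perp i),
    col.localAction_color g Q (Q.mem_of_adj hd hd'), (h'.image g).color_eq col (notMem_perp i)]

variable (B) in
/-- `c` is the projection of `d` on the `i`-panel of `c`. -/
def IsGate (i : I) (c d : Δ) : Prop := len M (gen M i * B.δ c d) = len M (B.δ c d) + 1

theorem exists_isGate {i : I} (P : B.Panel i) (d : Δ) : ∃ c ∈ P.1, B.IsGate i c d := by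
  obtain ⟨c, hc⟩ := P.nonempty
  rcases len_gen_mul M (B.δ c d) i with h | h
  · exact ⟨c, hc, h⟩
  · obtain ⟨c', h1, h2⟩ := B.exists_adjacent c d i
    refine ⟨c', P.mem_of_adj hc (Or.inr (B.δ_gen_symm h1)), ?_⟩
    rw [IsGate, h2, gen_mul_gen_mul]
    omega

theorem IsGate.eq {i : I} {c c' d : Δ} (h : B.IsGate i c d) (h' : B.IsGate i c' d)
    (hc : B.Adj i c c') : c = c' := by
  by_contra hne
  have h1 := (B.δ_adjacent c d c' i (hc.symm.δ_eq (Ne.symm hne))).2 h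
  rw [IsGate, h1, gen_mul_gen_mul] at h'
  rw [IsGate] at h
  omega

variable (B) in
/-- The Weyl distance from `c` to `d` commutes with `s_i` and is reduced with respect to `s_i`:
the `i`-panels of `c` and `d` are parallel, and `c` and `d` correspond to each other. -/
def Linked (i : I) (c d : Δ) : Prop :=
  gen M i * B.δ c d = B.δ c d * gen M i ∧ len M (B.δ c d * gen M i) = len M (B.δ c d) + 1

theorem linked_self (i : I) (c : Δ) : B.Linked i c c := by
  rw [Linked, δ_self, mul_one, one_mul, len_gen, len_one]
  exact ⟨rfl, rfl⟩

theorem Linked.of_δ_eq {i : I} {c d c' d' : Δ} (h : B.Linked i c d) (h' : B.δ c' d' = B.δ c d) :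
    B.Linked i c' d' := by
  rwa [Linked, h']

theorem Linked.isGate {i : I} {c d : Δ} (h : B.Linked i c d) : B.IsGate i c d := by
  rw [IsGate, h.1, h.2]

/-- The projection on an `i`-panel is unchanged along a panel, unless that panel is parallel to
it: this is the folding condition. -/
theorem IsGate.adj (hM : IsRightAngled M) {i k : I} {c d d' : Δ} (h : B.IsGate i c d)
    (hd : B.Adj k d d') : B.IsGate i c d' ∨ (k = i ∧ B.Linked i c d) := by
  rcases hd with rfl | hd
  · exact Or.inl h
  rcases B.δ_right (c := c) hd with h1 | h1
  · by_cases h2 : B.IsGate i c d'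
    · exact Or.inl h2
    right
    rw [IsGate, h1] at h2
    rw [IsGate] at h
    have h3 := len_gen_mul M (B.δ c d * gen M k) i
    have h4 := len_mul_gen M (gen M i * B.δ c d) k
    have h5 := len_mul_gen M (B.δ c d) k
    rw [mul_assoc] at h4
    have h6 : len M (B.δ c d * gen M k) = len M (B.δ c d) + 1 := by omega
    have h7 := folding M.toCoxeterSystem hM h h6 (show
      len M (gen M i * (B.δ c d * gen M k)) < len M (B.δ c d * gen M k) by omega)
    obtain rfl := eq_of_simple_mul_eq_mul_simple M.toCoxeterSystem hM h7
    exact ⟨rfl, h7, h6⟩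
  · left
    rwa [IsGate, h1]

theorem Linked.joined (hM : IsRightAngled M) {i : I} {c d : Δ} (h : B.Linked i c d) :
    B.Joined (perp M i) c d := by
  induction hn : len M (B.δ c d) generalizing d with
  | zero =>
    have h1 : B.δ c d = 1 := M.toCoxeterSystem.length_eq_zero_iff.1 hn
    obtain rfl := (B.δ_eq_one_iff c d).1 h1
    exact .refl
  | succ n ih =>
    have hne : B.δ c d ≠ 1 := by
      intro h
      rw [h, len_one] at hn
      omega
    obtain ⟨j, hj⟩ := M.toCoxeterSystem.exists_rightDescent_of_ne_one hne
    have hj' : len M (B.δ c d * gen M j) < len M (B.δ c d) := hj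
    obtain ⟨d1, hd1, hcd1⟩ := B.exists_adjacent_right c d j
    have h1 := len_mul_gen M (B.δ c d) j
    obtain ⟨hm, h2, h3⟩ := descent_of_commute M.toCoxeterSystem hM h.1 h.2 hj
    have h4 : B.Linked i c d1 := by
      rw [Linked, hcd1]
      exact ⟨h2, h3⟩
    exact (ih h4 (by rw [hcd1]; omega)).tail ⟨j, hm, Or.inr (B.δ_gen_symm hd1)⟩

theorem Linked.exists_right {i : I} {P Q : B.Panel i} {c d : Δ} (hc : c ∈ P.1) (hd : d ∈ Q.1)
    (h : B.Linked i c d) {x : Δ} (hx : x ∈ P.1) : ∃ y ∈ Q.1, B.δ x y = B.δ c d := by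
  by_cases hxc : c = x
  · subst hxc
    exact ⟨d, hd, rfl⟩
  · have h1 := (B.δ_adjacent c d x i ((P.adj hx hc).δ_eq (Ne.symm hxc))).2 h.isGate
    obtain ⟨y, h2, h3⟩ := B.exists_adjacent_right x d i
    refine ⟨y, Q.mem_of_adj hd (Or.inr h2), ?_⟩
    rw [h3, h1, h.1, mul_gen_mul_gen]

theorem Linked.inv {i : I} {c d : Δ} (h : B.Linked i c d) : B.Linked i d c := by
  obtain ⟨h1, h2⟩ := h
  have h3 : gen M i * (B.δ c d)⁻¹ = (B.δ c d)⁻¹ * gen M i := by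
    have := congrArg (·⁻¹) h1
    simpa [gen_inv] using this.symm
  refine ⟨by rw [B.δ_inv c d, h3], ?_⟩
  rw [B.δ_inv c d, ← h3, ← gen_inv M i, ← mul_inv_rev, len_inv, len_inv, h2]

theorem Linked.len_le {i : I} {P Q : B.Panel i} {c d : Δ} (hc : c ∈ P.1) (hd : d ∈ Q.1)
    (h : B.Linked i c d) {x y : Δ} (hx : x ∈ P.1) (hy : y ∈ Q.1) :
    len M (B.δ c d) ≤ len M (B.δ x y) := by
  obtain ⟨z, hz, hxz⟩ := h.exists_right hc hd hx
  rcases Q.adj hz hy with rfl | hzy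
  · rw [hxz]
  · rcases B.δ_right (c := x) hzy with h1 | h1
    · rw [h1, hxz, h.2]
      omega
    · rw [h1, hxz]

theorem Linked.projSet_eq {i : I} {P Q : B.Panel i} {c d : Δ} (hc : c ∈ P.1) (hd : d ∈ Q.1)
    (h : B.Linked i c d) : B.projSet Q.1 P.1 = Q.1 := by
  refine Set.Subset.antisymm (fun y ⟨x, _, hy, _⟩ => hy) fun y hy => ?_
  obtain ⟨x, hx, hxy⟩ := h.inv.exists_right hd hc hy
  refine ⟨x, hx, hy, fun z hz => ?_⟩
  rw [dist, dist, B.δ_inv y x, hxy, B.δ_inv c d, inv_inv]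
  exact h.len_le hc hd hx hz

theorem Linked.parallel {i : I} {P Q : B.Panel i} {c d : Δ} (hc : c ∈ P.1) (hd : d ∈ Q.1)
    (h : B.Linked i c d) : B.Parallel Q.1 P.1 :=
  ⟨h.projSet_eq hc hd, h.inv.projSet_eq hd hc⟩

/-- Either the projection of `Q` on `P` is a single chamber, or the two panels are parallel. -/
theorem isGate_or_linked (hM : IsRightAngled M) {i : I} (P Q : B.Panel i) :
    (∃ c ∈ P.1, ∀ d ∈ Q.1, B.IsGate i c d) ∨ ∃ c ∈ P.1, ∃ d ∈ Q.1, B.Linked i c d := by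
  obtain ⟨d, hd⟩ := Q.nonempty
  obtain ⟨c, hc, hcd⟩ := exists_isGate P d
  by_cases h : B.Linked i c d
  · exact Or.inr ⟨c, hc, d, hd, h⟩
  · exact Or.inl ⟨c, hc, fun e he =>
      (hcd.adj hM (Q.adj hd he)).resolve_right fun h' => h h'.2⟩

end Building
namespace LegalColoring

open Building

variable {I : Type*} {M : CoxeterMatrix I} {Δ : Type*} {B : Building M Δ} {Ω : I → Type*}
  (col : LegalColoring B Ω)

/-! ### Rungs and singularities -/

theorem localAction_eq {g : B.Aut} {i : I} {P : B.Panel i} {π : Equiv.Perm (Ω i)}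
    (h : ∀ x ∈ P.1, col.color i (g.1 x) = π (col.color i x)) : col.localAction g P = π := by
  ext a
  obtain ⟨x, hx, rfl⟩ := col.exists_color P a
  rw [col.localAction_color g P hx, h x hx]

theorem smul_eq_of_mem {g : B.Aut} {i : I} {P Q : B.Panel i} {c : Δ} (hc : c ∈ P.1)
    (hg : g.1 c ∈ Q.1) : g • P = Q :=
  Panel.eq_of_mem (c := g.1 c) (Set.mem_image_of_mem _ hc) hg

theorem commute_of_not_isRung (hM : IsRightAngled M) {i : I} {P : B.Panel i} (hP : ¬ IsRung P)
    {j k : I} (hj : j ∈ perp M i) (hk : k ∈ perp M i) (hjk : j ≠ k) : M j k = 2 := by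
  refine (hM j k hjk).resolve_right fun h0 => hP ?_
  obtain ⟨c, hc⟩ := P.nonempty
  refine ⟨{d | B.δ c d ∈ parabolic M {i, j, k}}, ⟨j, k, hj, hk, h0, c, rfl⟩, fun d hd => ?_⟩
  rw [P.eq_panelOf hc] at hd
  exact Subgroup.closure_mono (Set.image_mono (by simp)) hd

/-- A panel that is not a rung is parallel to finitely many panels only. -/
theorem finite_linked (col : LegalColoring B Ω) [Finite I] [∀ i, Finite (Ω i)]
    (hM : IsRightAngled M) {i : I} {P : B.Panel i} (hP : ¬ IsRung P) :
    {Q : B.Panel i | ∃ c ∈ P.1, ∃ d ∈ Q.1, B.Linked i c d}.Finite := by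
  obtain ⟨c, hc⟩ := P.nonempty
  have hfin : ∀ c, {d | B.Joined (perp M i) c d}.Finite := by
    intro c
    have h := finite_joined hM col (Set.toFinite (perp M i)).toFinset (fun j hj k hk =>
      commute_of_not_isRung hM hP (by simpa using hj) (by simpa using hk)) c
    simpa using h
  refine (((finite_adj col i c).biUnion fun x _ => hfin x).image (B.panelOf i)).subset ?_
  rintro Q ⟨x, hx, d, hd, h⟩
  refine ⟨d, ?_, (Q.eq_panelOf hd).symm⟩
  simp only [Set.mem_iUnion]
  exact ⟨x, P.adj hc hx, h.joined hM⟩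

/-- Infinitely many panels have the same local actions as a given rung: those parallel to it along
the infinite dihedral direction of the ladder. -/
theorem infinite_of_isRung (hM : IsRightAngled M) {i : I} {P : B.Panel i} (hP : IsRung P) :
    {Q : B.Panel i | ∀ g : B.Aut, col.localAction g Q = col.localAction g P}.Infinite := by
  obtain ⟨R, ⟨j, k, hij, hik, hjk, -⟩, -⟩ := hP
  obtain ⟨c, hc⟩ := P.nonempty
  have hex : ∀ n : ℕ, ∃ d, B.δ c d = (gen M j * gen M k) ^ n ∧ B.Joined (perp M i) c d := by
    intro n
    induction n with
    | zero => exact ⟨c, by rw [δ_self, pow_zero], .refl⟩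
    | succ n ih =>
      obtain ⟨d, h1, h2⟩ := ih
      obtain ⟨d', h3, h4⟩ := B.exists_adjacent_right c d j
      obtain ⟨d'', h5, h6⟩ := B.exists_adjacent_right c d' k
      refine ⟨d'', ?_, (h2.tail ⟨j, hij, Or.inr h3⟩).tail ⟨k, hik, Or.inr h5⟩⟩
      rw [h6, h4, h1, pow_succ, mul_assoc]
  choose d hd hjoin using hex
  have hne : ∀ {a b : I}, M a b ≠ 1 → a ≠ b := by
    rintro a b h rfl
    exact h (M.diagonal a)
  obtain ⟨φ, hφ, hφ'⟩ := exists_toDihedral M.toCoxeterSystem hM (hne (by omega)) hjk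
  have hφ1 : φ (gen M j * gen M k) = DihedralGroup.r 1 := hφ
  have hφi : φ (gen M i) = 1 := hφ' i (hne (by omega)) (hne (by omega))
  refine Set.infinite_of_injective_forall_mem (f := fun n => B.panelOf i (d n)) ?_ ?_
  · intro m n hmn
    have hadj : B.Adj i (d m) (d n) := by
      rw [← mem_panelOf, show B.panelOf i (d m) = B.panelOf i (d n) from hmn]
      exact mem_panelOf_self i (d n)
    have h1 : φ (B.δ c (d n)) = φ (B.δ c (d m)) := by
      rcases hadj with h | h
      · rw [h]
      · rcases B.δ_right (c := c) h with h | h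
        · rw [h, map_mul, hφi, mul_one]
        · rw [h]
    rw [hd, hd, map_pow, map_pow, hφ1, ← zpow_natCast, ← zpow_natCast, dihedral_r_one_zpow,
      dihedral_r_one_zpow] at h1
    have h2 : ((n : ℕ) : ℤ) = m := DihedralGroup.r.inj h1
    exact_mod_cast h2.symm
  · intro n g
    exact localAction_eq_of_joined hM col hc (mem_panelOf_self i (d n)) (hjoin n) g

variable (F F' : ∀ i, Subgroup (Equiv.Perm (Ω i)))

theorem not_isRung_of_mem_singularities (hM : IsRightAngled M) {g : B.Aut}
    (hg : g ∈ col.almostUniversal F) {i : I} {P : B.Panel i} (hP : P ∈ col.singularities F g i) :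
    ¬ IsRung P := by
  intro hr
  refine col.infinite_of_isRung hM hr ((hg i).subset ?_)
  intro Q hQ
  change col.localAction g Q ∉ F i
  rw [hQ g]
  exact hP

/-! ### Elements with prescribed singularities -/

/-- An automorphism with local action `τ` at all panels parallel to `P`, where `τ` agrees with
`f x` at `x`: away from these panels, the `i`-color of a chamber is changed by `f x`, where `x` is
the `i`-color of its projection on `P`. -/
theorem exists_aut_localAction (hM : IsRightAngled M) {i : I} (P : B.Panel i)
    (τ : Equiv.Perm (Ω i)) (f : Ω i → Equiv.Perm (Ω i)) (hf : ∀ x, f x x = τ x) :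
    ∃ h : B.Aut, h • P = P ∧ (∀ j ≠ i, ∀ Q : B.Panel j, col.localAction h Q = 1) ∧
      (∀ Q : B.Panel i, (∃ c ∈ P.1, ∃ d ∈ Q.1, B.Linked i c d) → col.localAction h Q = τ) ∧
      ∀ Q : B.Panel i, (¬ ∃ c ∈ P.1, ∃ d ∈ Q.1, B.Linked i c d) →
        ∃ x, col.localAction h Q = f x := by
  classical
  choose p hpP hp using fun d => exists_isGate P d
  have hpeq : ∀ c d, c ∈ P.1 → B.IsGate i c d → p d = c := fun c d hc h =>
    (hp d).eq h (P.adj (hpP d) hc)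
  let μ : ∀ j, Δ → Ω j :=
    Function.update (fun j x => col.color j x) i fun x => f (col.color i (p x)) (col.color i x)
  have hμi : ∀ x, μ i x = f (col.color i (p x)) (col.color i x) := fun x => by simp [μ]
  have hμj : ∀ j ≠ i, ∀ x, μ j x = col.color j x := fun j hj x => by simp [μ, hj]
  have hlinked : ∀ Q : B.Panel i, (∃ c ∈ P.1, ∃ d ∈ Q.1, B.Linked i c d) →
      ∀ x ∈ Q.1, μ i x = τ (col.color i x) := by
    rintro Q ⟨c, hc, d, hd, h⟩ x hx
    obtain ⟨y, hy, hxy⟩ := h.inv.exists_right hd hc hx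
    have h1 : B.Linked i y x := (h.inv.of_δ_eq hxy).inv
    rw [hμi, hpeq y x hy h1.isGate, (h1.joined hM).color_eq col (notMem_perp i), hf]
  have hunlinked : ∀ Q : B.Panel i, (¬ ∃ c ∈ P.1, ∃ d ∈ Q.1, B.Linked i c d) →
      ∃ a, ∀ x ∈ Q.1, μ i x = f a (col.color i x) := by
    intro Q h
    obtain ⟨c, hc, hcQ⟩ := (isGate_or_linked hM P Q).resolve_right h
    exact ⟨col.color i c, fun x hx => by rw [hμi, hpeq c x hc (hcQ x hx)]⟩
  obtain ⟨c, hc⟩ := P.nonempty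
  obtain ⟨d, hd, hdc⟩ := col.exists_color P (τ (col.color i c))
  obtain ⟨h, hcd, hh⟩ := col.exists_aut hM μ (c := c) (d := d) (by
      intro j k x y hjk hxy
      by_cases hj : j = i
      · subst hj
        rcases (hp x).adj hM hxy with h | h
        · rw [hμi, hμi, hpeq _ _ (hpP x) h, col.color_eq_of_adj hjk hxy]
        · exact absurd h.1.symm hjk
      · rw [hμj j hj, hμj j hj, col.color_eq_of_adj hjk hxy])
    (by
      intro j Q
      by_cases hj : j = i
      · subst hj
        by_cases hl : ∃ c ∈ P.1, ∃ d ∈ Q.1, B.Linked j c d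
        · exact ⟨τ, hlinked Q hl⟩
        · obtain ⟨a, ha⟩ := hunlinked Q hl
          exact ⟨f a, ha⟩
      · exact ⟨1, fun x _ => hμj j hj x⟩)
    (by
      intro j
      by_cases hj : j = i
      · subst hj
        rw [hdc, hlinked P ⟨c, hc, c, hc, linked_self j c⟩ c hc]
      · rw [hμj j hj, col.color_eq_of_adj hj (P.adj hc hd)])
  refine ⟨h, smul_eq_of_mem hc (hcd ▸ hd), ?_, ?_, ?_⟩
  · intro j hj Q
    exact col.localAction_eq fun x _ => (hh j x).trans (hμj j hj x)
  · intro Q hQ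
    exact col.localAction_eq fun x hx => (hh i x).trans (hlinked Q hQ x hx)
  · intro Q hQ
    obtain ⟨a, ha⟩ := hunlinked Q hQ
    exact ⟨a, col.localAction_eq fun x hx => (hh i x).trans (ha x hx)⟩

/-- `K_P` realizes every local action `τ ∈ F' i` at `P`, by an element `h` whose local action at
each of its singularities is that of any automorphism with local action `τ` at `P`. -/
theorem exists_mem_panelGroup [Finite I] [∀ i, Finite (Ω i)] (hM : IsRightAngled M)
    (hF : ∀ i, F i ≤ F' i) (hF' : ∀ i, F' i ≤ youngOvergroup (F i)) {i : I} {P : B.Panel i}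
    (hP : ¬ IsRung P) {τ : Equiv.Perm (Ω i)} (hτ : τ ∈ F' i) :
    ∃ h ∈ col.panelGroup F F' P, col.localAction h P = τ ∧
      ∀ g : B.Aut, col.localAction g P = τ → ∀ (j : I) (Q : B.Panel j),
        col.localAction h Q ∈ F j ∨ col.localAction g Q = col.localAction h Q := by
  have hex : ∀ x, ∃ f ∈ F i, f x = τ x := by
    intro x
    obtain ⟨f, hf⟩ : τ x ∈ MulAction.orbit (F i) x := hF' i hτ x
    exact ⟨f.1, f.2, hf⟩
  choose f hfF hf using hex
  obtain ⟨h, hhP, h1, h2, h3⟩ := col.exists_aut_localAction hM P τ f hf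
  have hor : ∀ (j : I) (Q : B.Panel j), col.localAction h Q ∈ F j ∨ ∃ hj : j = i,
      hj ▸ Q ∈ {Q : B.Panel i | ∃ c ∈ P.1, ∃ d ∈ Q.1, B.Linked i c d} := by
    intro j Q
    by_cases hj : j = i
    · subst hj
      by_cases hl : ∃ c ∈ P.1, ∃ d ∈ Q.1, B.Linked j c d
      · exact Or.inr ⟨rfl, hl⟩
      · obtain ⟨x, hx⟩ := h3 Q hl
        exact Or.inl (hx ▸ hfF x)
    · rw [h1 j hj Q]
      exact Or.inl (one_mem _)
  obtain ⟨c, hc⟩ := P.nonempty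
  refine ⟨h, ⟨⟨?_, ?_⟩, hhP, ?_⟩, h2 P ⟨c, hc, c, hc, linked_self i c⟩, ?_⟩
  · intro j
    by_cases hj : j = i
    · subst hj
      refine (col.finite_linked hM hP).subset fun Q hQ => ?_
      rcases hor j Q with h | ⟨_, h⟩
      · exact absurd h hQ
      · exact h
    · refine Set.finite_empty.subset fun Q hQ => hQ ?_
      rw [h1 j hj Q]
      exact one_mem _
  · intro j Q
    rcases hor j Q with h | ⟨rfl, h⟩
    · exact hF j h
    · rw [h2 Q h]
      exact hτ
  · intro j Q hQ
    rcases hor j Q with h | ⟨rfl, c, hc, d, hd, h⟩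
    · exact absurd h hQ
    · exact h.parallel hc hd
  · intro g hg j Q
    rcases hor j Q with h | ⟨rfl, h⟩
    · exact Or.inl h
    · right
      rw [h2 Q h, ← hg]
      obtain ⟨c, hc, d, hd, h⟩ := h
      exact localAction_eq_of_joined hM col hc hd (h.joined hM) g

/-! ### Generation -/

/-- Harmonious panels lie in the same orbit of `U(F)`. -/
theorem exists_mem_universal_smul_eq (hM : IsRightAngled M) {i : I} {P Q : B.Panel i}
    (h : col.Harmonious F {i} P.1 Q.1) : ∃ u ∈ col.universal F, u • P = Q := by
  obtain ⟨c, hc⟩ := P.nonempty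
  obtain ⟨d, hd, hdc⟩ := col.exists_color Q (col.color i c)
  have hex : ∀ j, ∃ f ∈ F j, f (col.color j c) = col.color j d := by
    intro j
    by_cases hj : j = i
    · subst hj
      exact ⟨1, one_mem _, hdc.symm⟩
    · obtain ⟨f, hf⟩ := h j hj c hc d hd
      exact ⟨f.1, f.2, hf⟩
  choose f hfF hf using hex
  obtain ⟨u, hu, huc⟩ := col.exists_aut hM (fun j x => f j (col.color j x)) (c := c) (d := d)
    (fun j k x y hjk hxy => by rw [col.color_eq_of_adj hjk hxy]) (fun j Q => ⟨f j, fun _ _ => rfl⟩)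
    hf
  refine ⟨u, fun j R => ?_, smul_eq_of_mem hc (hu ▸ hd)⟩
  rw [col.localAction_eq fun x _ => huc j x]
  exact hfF j

theorem universal_le_restricted (hF : ∀ i, F i ≤ F' i) :
    col.universal F ≤ col.restricted F F' := by
  intro g hg
  exact ⟨fun i => Set.finite_empty.subset fun P hP => hP (hg i P), fun i P => hF i (hg i P)⟩

theorem conj_mem_panelGroup (hF : ∀ i, F i ≤ F' i) {i : I} {P : B.Panel i} {u h : B.Aut}
    (hu : u ∈ col.universal F) (hh : h ∈ col.panelGroup F F' P) :
    u * h * u⁻¹ ∈ col.panelGroup F F' (u • P) := by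
  have hu' := col.universal_le_restricted F F' hF hu
  refine ⟨mul_mem (mul_mem hu' hh.1) (inv_mem hu'), ?_, ?_⟩
  · rw [mul_smul, inv_smul_smul, mul_smul, hh.2.1]
  · intro j Q hQ
    have h1 : u⁻¹ • Q ∈ col.singularities F h j := by
      intro hc
      apply hQ
      rw [localAction_mul, localAction_mul]
      exact mul_mem (mul_mem (hu j _) hc) (inv_mem hu j Q)
    have h2 := (hh.2.2 j _ h1).image u
    rwa [← coe_smul, ← coe_smul, smul_inv_smul] at h2

/-- The set of all singularities, of all types. -/
def allSingularities (g : B.Aut) : Set (Σ j, B.Panel j) :=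
  {q | q.2 ∈ col.singularities F g q.1}

theorem finite_allSingularities [Finite I] {g : B.Aut} (hg : g ∈ col.almostUniversal F) :
    (col.allSingularities F g).Finite := by
  refine (Set.finite_iUnion fun j => (hg j).image (Sigma.mk j)).subset ?_
  rintro ⟨j, Q⟩ hQ
  exact Set.mem_iUnion.2 ⟨j, Q, hQ, rfl⟩

/-- A subgroup containing `U(F)` and all `K_P`, for `P` not a rung, contains `G(F, F')`: an element
`g` with a singularity `P` is multiplied by the inverse of an element of `K_P` with the same local
action at `P`, which removes this singularity and creates none. -/
theorem mem_of_forall_panelGroup_le [Finite I] [∀ i, Finite (Ω i)] (hM : IsRightAngled M)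
    (hF : ∀ i, F i ≤ F' i) (hF' : ∀ i, F' i ≤ youngOvergroup (F i)) {C : Subgroup B.Aut}
    (hU : col.universal F ≤ C)
    (hK : ∀ (i : I) (P : B.Panel i), ¬ IsRung P → col.panelGroup F F' P ≤ C) {g : B.Aut}
    (hg : g ∈ col.restricted F F') : g ∈ C := by
  induction hn : (col.allSingularities F g).ncard using Nat.strong_induction_on generalizing g with
  | _ n ih =>
    by_cases hs : g ∈ col.universal F
    · exact hU hs
    obtain ⟨i, P, hP⟩ : ∃ (i : I) (P : B.Panel i), col.localAction g P ∉ F i := by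
      by_contra hcon
      push Not at hcon
      exact hs hcon
    have hr := col.not_isRung_of_mem_singularities F hM hg.1 hP
    obtain ⟨h, hh, hhP, hor⟩ := col.exists_mem_panelGroup F F' hM hF hF' hr (hg.2 i P)
    have hfin := col.finite_allSingularities F hg.1
    have hlocal : ∀ (j : I) (Q : B.Panel j), col.localAction (g * h⁻¹) (h • Q) =
        col.localAction g Q * (col.localAction h Q)⁻¹ := by
      intro j Q
      rw [localAction_mul, localAction_inv, inv_smul_smul]
    have hsub : col.allSingularities F (g * h⁻¹) ⊆ (fun q : Σ j, B.Panel j => ⟨q.1, h • q.2⟩) ''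
        (col.allSingularities F g \ {⟨i, P⟩}) := by
      rintro ⟨j, Q⟩ hQ
      obtain ⟨Q, rfl⟩ : ∃ R, Q = h • R := ⟨h⁻¹ • Q, by rw [smul_inv_smul]⟩
      have hQ' : col.localAction g Q * (col.localAction h Q)⁻¹ ∉ F j := by
        rw [← hlocal]
        exact hQ
      refine ⟨⟨j, Q⟩, ⟨fun hc => hQ' ?_, ?_⟩, rfl⟩
      · rcases hor g rfl j Q with h1 | h1
        · exact mul_mem hc (inv_mem h1)
        · rw [h1, mul_inv_cancel]
          exact one_mem _
      · rintro h1
        obtain ⟨rfl, h2⟩ := Sigma.mk.inj (Set.mem_singleton_iff.1 h1)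
        obtain rfl := eq_of_heq h2
        apply hQ'
        rw [hhP, mul_inv_cancel]
        exact one_mem _
    have hlt : (col.allSingularities F (g * h⁻¹)).ncard < n := by
      calc _ ≤ _ := Set.ncard_le_ncard hsub (hfin.sdiff.image _)
        _ ≤ _ := Set.ncard_image_le hfin.sdiff
        _ < _ := Set.ncard_lt_ncard (Set.sdiff_singleton_ssubset.2 hP) hfin
        _ = n := hn
    have hgh := ih _ hlt (mul_mem hg (inv_mem hh.1)) rfl
    have := mul_mem hgh (hK i P hr hh)
    rwa [inv_mul_cancel_right] at this

end LegalColoring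
end RightAngled

open RightAngled in
theorem mainTheorem6 {I : Type*} [Finite I] (M : CoxeterMatrix I) (hM : IsRightAngled M)
    {Δ : Type*} [Nonempty Δ] (B : Building M Δ)
    {Ω : I → Type*} [∀ i, Finite (Ω i)] (col : LegalColoring B Ω)
    (F F' : ∀ i, Subgroup (Equiv.Perm (Ω i)))
    (hF : ∀ i, F i ≤ F' i) (hF' : ∀ i, F' i ≤ youngOvergroup (F i))
    (H : ∀ i, Set (B.Panel i)) (hH : col.IsRepresentatives F H) :
    col.restricted F F' =
      Subgroup.closure ((col.universal F : Set B.Aut) ∪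
        ⋃ i, ⋃ P ∈ H i, (col.panelGroup F F' P : Set B.Aut)) := by
  apply le_antisymm
  · intro g hg
    have hU : col.universal F ≤ Subgroup.closure ((col.universal F : Set B.Aut) ∪
        ⋃ i, ⋃ P ∈ H i, (col.panelGroup F F' P : Set B.Aut)) :=
      fun u hu => Subgroup.subset_closure (Or.inl hu)
    refine col.mem_of_forall_panelGroup_le F F' hM hF hF' hU ?_ hg
    intro i P hP h hh
    obtain ⟨Q, ⟨hQ, hPQ⟩, -⟩ := hH.2 i P hP
    obtain ⟨u, hu, rfl⟩ := col.exists_mem_universal_smul_eq F hM hPQ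
    have h1 := Subgroup.subset_closure (k := (col.universal F : Set B.Aut) ∪
        ⋃ i, ⋃ P ∈ H i, (col.panelGroup F F' P : Set B.Aut))
      (Or.inr (Set.mem_iUnion.2 ⟨i, Set.mem_iUnion₂.2
        ⟨u • P, hQ, col.conj_mem_panelGroup F F' hF hu hh⟩⟩))
    have h2 := mul_mem (mul_mem (inv_mem (hU hu)) h1) (hU hu)
    rwa [show u⁻¹ * (u * h * u⁻¹) * u = h by group] at h2
  · rw [Subgroup.closure_le]
    rintro g (hg | hg)
    · exact col.universal_le_restricted F F' hF hg
    · obtain ⟨i, hg⟩ := Set.mem_iUnion.1 hg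
      obtain ⟨P, -, hg⟩ := Set.mem_iUnion₂.1 hg
      exact hg.1
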